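/- Let $F$ be a non-Archimedean local field with ring of integers $O$, maximal ideal $\mathfrak p=\varpi O$ and residue field $\mathbb F=O/\mathfrak p$ (of any characteristic), and put $O_i=O/\mathfrak p^i$. Fix a continuous unitary character $\tau$ of the additive group $F$ with $\{x\in F\mid \tau(xy)=1\ \text{for all}\ y\in O\}=O$. Let $l\ge 2$, $r=2l-1$, $G_r=GL_n(O_r)$, and for $0<i<r$ let $K_i$ be the kernel of $G_r\to G_i=GL_n(O_i)$. For a subspace $U\subset M_n(\mathbb F)$ let $K_i(U)$ be the inverse image of $U$ under the homomorphism $K_i\to M_n(\mathbb F)$, $1_n+\varpi^iX \bmod \mathfrak p^r\mapsto X\bmod\mathfrak p$. Let $\beta\in M_n(O)$ be such that $\overline\beta=\beta\bmod\mathfrak p\in M_n(\mathbb F)$ is regular, i.e. the characteristic polynomial of $\overline\beta$ equals its minimal polynomial. Let $\psi_\beta$ be the character of $K_l$ given by $\psi_\beta(1_n+\varpi^lX\bmod\mathfrak p^r)=\tau(\varpi^{-(l-1)}\mathrm{tr}(X\beta))$, let $\mathcal C=(O_r[\beta_r])^\times\subset G_r$ with $\beta_r=\beta\bmod\mathfrak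 p^r$, and let $Y(\psi_\beta)$ be the set of group homomorphisms $\psi:K_{l-1}(\mathbb F[\overline\beta])\to\mathbb C^\times$ with $\psi|_{K_l}=\psi_\beta$. A complex representation $\pi$ of a group containing $N$ lies over a character $\psi$ of $N$ if $\dim\mathrm{Hom}_N(\psi,\pi)>0$; $\mathrm{Irr}(G_r\mid\psi_\beta)$ denotes the set of equivalence classes of irreducible complex representations of $G_r$ lying over $\psi_\beta$. For every $\psi\in Y(\psi_\beta)$ there is, up to equivalence, a unique irreducible representation $\pi_\psi$ of $K_{l-1}$ lying over $\psi$, and it is stable under conjugation by $\mathcal C$. Choose invertible operators $U(\varepsilon)$ $(\varepsilon\in\mathcal C)$ on the space of $\pi_\psi$ with $\pi_\psi(\varepsilon k\varepsilon^{-1})=U(\varepsilon)\pi_\psi(k)U(\varepsilon)^{-1}$ for all $k\in K_{l-1}$; then $U(\varepsilon)U(\eta)=c_U(\varepsilon,\eta)U(\varepsilon\eta)$ defines a $2$-cocycle $c_U$, whose class $c(\psi)\in H^2(\mathcal C,\mathbb C^\times)$ (trivial action) does not depend on the choice of $U$. Theorem. Assume that $c(\psi)\in H^2(\mathcal C,\mathbb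 C^\times)$ is trivial for every $\psi\in Y(\psi_\beta)$. Then every $\pi_\psi$, $\psi\in Y(\psi_\beta)$, extends to a representation of $\mathcal CK_{l-1}$, and for every choice of extensions $\widetilde\pi_\psi$ the map $$(\chi,\psi)\mapsto \mathrm{Ind}_{\mathcal CK_{l-1}}^{G_r}(\chi\otimes\widetilde\pi_\psi)$$ is a bijection from $\mathrm{Irr}(\mathcal C/\mathcal C\cap K_{l-1})\times Y(\psi_\beta)$ onto $\mathrm{Irr}(G_r\mid\psi_\beta)$. Here $\mathrm{Irr}(\mathcal C/\mathcal C\cap K_{l-1})$ is the group of characters of the finite abelian group $\mathcal C/\mathcal C\cap K_{l-1}$, each of which is regarded as a character of $\mathcal CK_{l-1}$ trivial on $K_{l-1}$. -/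

import Mathlib

open CategoryTheory
open scoped ValuativeRel Matrix

universe u

namespace RegChar

/-! ### Groups attached to `GL_n` over the quotients of a discrete valuation ring -/

section Groups

variable (O : Type u) [CommRing O] [IsLocalRing O] (n : ℕ)

/-- The ring `O_i = O / 𝔭^i`. -/
abbrev Level (i : ℕ) : Type u := O ⧸ (IsLocalRing.maximalIdeal O) ^ i

/-- The group `G_r = GL_n(O_r)`. -/
abbrev G (r : ℕ) : Type u := GL (Fin n) (Level O r)

/-- `K_i`, the kernel of the canonical homomorphism `G_r → G_i`, for `i ≤ r`. -/
def K {i r : ℕ} (h : i ≤ r) : Subgroup (G O n r) :=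
  (Matrix.GeneralLinearGroup.map (n := Fin n)
    (Ideal.Quotient.factorPow (IsLocalRing.maximalIdeal O) h)).ker

instance K_normal {i r : ℕ} (h : i ≤ r) : (K O n h).Normal := by
  unfold K; infer_instance

variable {O n}

/-- The class of a matrix over `O` modulo `𝔭^i`. -/
def red (i : ℕ) (X : Matrix (Fin n) (Fin n) O) : Matrix (Fin n) (Fin n) (Level O i) :=
  X.map (Ideal.Quotient.mk ((IsLocalRing.maximalIdeal O) ^ i))

/-- The class of a matrix over `O` modulo `𝔭`, with entries in the residue field. -/
noncomputable def bar (X : Matrix (Fin n) (Fin n) O) :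
    Matrix (Fin n) (Fin n) (IsLocalRing.ResidueField O) :=
  X.map (IsLocalRing.residue O)

/-- `k = 1_n + ϖ^i X (mod 𝔭^r)`. -/
def IsCoeff (ϖ : O) (i : ℕ) {r : ℕ} (k : G O n r) (X : Matrix (Fin n) (Fin n) O) : Prop :=
  (k : Matrix (Fin n) (Fin n) (Level O r)) = red r (1 + ϖ ^ i • X)

/-- The group `𝒞 = (O_r[β_r])ˣ`, as a subgroup of `G_r`. -/
def C (r : ℕ) (β : Matrix (Fin n) (Fin n) O) : Subgroup (G O n r) :=
  (Algebra.adjoin (Level O r) {red r β}).toSubmonoid.units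

/-- The subspace `𝔽[β̄]` of `M_n(𝔽)`, where `β̄ = β (mod 𝔭)`. -/
noncomputable def resAlg (β : Matrix (Fin n) (Fin n) O) :
    Submodule (IsLocalRing.ResidueField O)
      (Matrix (Fin n) (Fin n) (IsLocalRing.ResidueField O)) :=
  Subalgebra.toSubmodule (Algebra.adjoin (IsLocalRing.ResidueField O) {bar β})

/-- `β̄` is regular: its characteristic polynomial equals its minimal polynomial. -/
def IsRegularMat (β : Matrix (Fin n) (Fin n) O) : Prop :=
  (bar β).charpoly = minpoly (IsLocalRing.ResidueField O) (bar β)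

lemma red_add (i : ℕ) (X Y : Matrix (Fin n) (Fin n) O) : red i (X + Y) = red i X + red i Y :=
  Matrix.map_add _ (map_add _) X Y

lemma red_mul (i : ℕ) (X Y : Matrix (Fin n) (Fin n) O) : red i (X * Y) = red i X * red i Y :=
  Matrix.map_mul

lemma red_one (i : ℕ) : red i (1 : Matrix (Fin n) (Fin n) O) = 1 :=
  Matrix.map_one _ (map_zero _) (map_one _)

lemma bar_add (X Y : Matrix (Fin n) (Fin n) O) : bar (X + Y) = bar X + bar Y :=
  Matrix.map_add _ (map_add _) X Y

lemma K_anti {i j r : ℕ} (hij : i ≤ j) (hjr : j ≤ r) : K O n hjr ≤ K O n (hij.trans hjr) := by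
  intro k hk
  have hk' : Matrix.GeneralLinearGroup.map (n := Fin n)
      (Ideal.Quotient.factorPow (IsLocalRing.maximalIdeal O) hjr) k = 1 := hk
  have h := congrArg (Matrix.GeneralLinearGroup.map (n := Fin n)
      (Ideal.Quotient.factorPow (IsLocalRing.maximalIdeal O) hij)) hk'
  rw [map_one] at h
  change _ = _
  rw [← h]
  ext a b
  simp only [Matrix.GeneralLinearGroup.map_apply]
  obtain ⟨x, hx⟩ := Ideal.Quotient.mk_surjective (k.val a b)
  rw [← hx]
  rfl

lemma IsCoeff.mul {ϖ : O} {i r : ℕ} {k k' : G O n r} {X X' : Matrix (Fin n) (Fin n) O}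
    (h : IsCoeff ϖ i k X) (h' : IsCoeff ϖ i k' X') :
    IsCoeff ϖ i (k * k') (X + X' + ϖ ^ i • (X * X')) := by
  unfold IsCoeff at *
  rw [Units.val_mul, h, h', ← red_mul]
  congr 1
  simp only [add_mul, mul_add, one_mul, mul_one, smul_add, smul_mul_assoc, mul_smul_comm]
  abel

lemma IsCoeff.one {ϖ : O} {i r : ℕ} : IsCoeff ϖ i (1 : G O n r) 0 := by
  simp [IsCoeff, red_one]

end Groups

section GroupsDVR

variable {O : Type u} [CommRing O] [IsDomain O] [IsDiscreteValuationRing O] {n : ℕ} {ϖ : O}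

lemma mem_pow_iff (hϖ : Irreducible ϖ) {i : ℕ} {x : O} :
    x ∈ (IsLocalRing.maximalIdeal O) ^ i ↔ ϖ ^ i ∣ x := by
  rw [hϖ.maximalIdeal_eq, Ideal.span_singleton_pow, Ideal.mem_span_singleton]

/-- Every element of `K_i` is of the form `1_n + ϖ^i X (mod 𝔭^r)`. -/
lemma exists_coeff (hϖ : Irreducible ϖ) {i r : ℕ} {h : i ≤ r} (k : K O n h) :
    ∃ X, IsCoeff ϖ i (k : G O n r) X := by
  obtain ⟨k, hk⟩ := k
  have hlift : ∀ a b, ∃ x : O, Ideal.Quotient.mk ((IsLocalRing.maximalIdeal O) ^ r) x =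
      (k : Matrix (Fin n) (Fin n) (Level O r)) a b :=
    fun a b => Ideal.Quotient.mk_surjective _
  choose M hM using hlift
  have hd : ∀ a b, ∃ y : O, M a b - (1 : Matrix (Fin n) (Fin n) O) a b = ϖ ^ i * y := by
    intro a b
    have h1 : (Matrix.GeneralLinearGroup.map (n := Fin n)
      (Ideal.Quotient.factorPow (IsLocalRing.maximalIdeal O) h)) k = 1 := hk
    have h2 := congrArg (fun g : G O n i => (g : Matrix (Fin n) (Fin n) (Level O i)) a b) h1
    simp only [Matrix.GeneralLinearGroup.map_apply, Units.val_one, ← hM] at h2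
    have h3 : Ideal.Quotient.mk ((IsLocalRing.maximalIdeal O) ^ i) (M a b) =
        Ideal.Quotient.mk _ ((1 : Matrix (Fin n) (Fin n) O) a b) := by
      refine h2.trans ?_
      by_cases hab : a = b <;> simp [Matrix.one_apply, hab]
    exact (mem_pow_iff hϖ).1 (Ideal.Quotient.eq.1 h3)
  choose X hX using hd
  refine ⟨Matrix.of X, ?_⟩
  ext a b
  simp only [red, Matrix.map_apply, Matrix.add_apply, Matrix.smul_apply, Matrix.of_apply,
    smul_eq_mul, ← hX, add_sub_cancel]
  exact (hM a b).symm

/-- The matrix `X` in `1_n + ϖ^i X (mod 𝔭^r)` is unique modulo `𝔭^(r-i)`. -/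
lemma IsCoeff.unique (hϖ : Irreducible ϖ) {i r : ℕ} (h : i ≤ r) {k : G O n r} {X X' : Matrix (Fin n) (Fin n) O}
    (hX : IsCoeff ϖ i k X) (hX' : IsCoeff ϖ i k X') :
    ∃ Z : Matrix (Fin n) (Fin n) O, X = X' + ϖ ^ (r - i) • Z := by
  have hd : ∀ a b, ∃ z : O, X a b - X' a b = ϖ ^ (r - i) * z := by
    intro a b
    have h1 : red r (1 + ϖ ^ i • X) = red r (1 + ϖ ^ i • X') := hX.symm.trans hX'
    have h2 := congrFun (congrFun h1 a) b
    have h3 := (mem_pow_iff hϖ).1 (Ideal.Quotient.eq.1 h2)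
    have h4 : ϖ ^ i * ϖ ^ (r - i) ∣ ϖ ^ i * (X a b - X' a b) := by
      rw [← pow_add, Nat.add_sub_cancel' h]
      convert h3 using 1
      simp only [Matrix.add_apply, Matrix.smul_apply, smul_eq_mul]
      ring
    exact (mul_dvd_mul_iff_left (pow_ne_zero _ hϖ.ne_zero)).1 h4
  choose Z hZ using hd
  refine ⟨Matrix.of Z, ?_⟩
  ext a b
  simp [← hZ]

lemma bar_smul_pow (hϖ : Irreducible ϖ) {j : ℕ} (hj : 0 < j) (Z : Matrix (Fin n) (Fin n) O) :
    bar (ϖ ^ j • Z) = 0 := by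
  ext a b
  have h : IsLocalRing.residue O ϖ = 0 :=
    (IsLocalRing.residue_eq_zero_iff _).2 (by
      rw [hϖ.maximalIdeal_eq]; exact Ideal.mem_span_singleton_self _)
  simp [bar, h, hj.ne']

/-- For `0 < i < r`, the homomorphism `1_n + ϖ^i X (mod 𝔭^r) ↦ X (mod 𝔭)` from `K_i` to the
additive group `M_n(𝔽)`; see `coeffHom_eq`. -/
noncomputable def coeffHom (hϖ : Irreducible ϖ) {i r : ℕ} (hi : 0 < i) (hir : i < r) :
    K O n hir.le →*
      Multiplicative (Matrix (Fin n) (Fin n) (IsLocalRing.ResidueField O)) :=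
  MonoidHom.mk' (fun k => Multiplicative.ofAdd (bar (exists_coeff hϖ k).choose)) (by
    intro k k'
    rw [← ofAdd_add]
    congr 1
    obtain ⟨Z, hZ⟩ := IsCoeff.unique hϖ hir.le (exists_coeff hϖ (k * k')).choose_spec
      ((exists_coeff hϖ k).choose_spec.mul (exists_coeff hϖ k').choose_spec)
    rw [hZ, bar_add, bar_add, bar_smul_pow hϖ (Nat.sub_pos_of_lt hir), bar_add,
      bar_smul_pow hϖ hi, add_zero, add_zero])

lemma coeffHom_eq (hϖ : Irreducible ϖ) {i r : ℕ} (hi : 0 < i) (hir : i < r) (k : K O n hir.le)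
    {X : Matrix (Fin n) (Fin n) O} (hX : IsCoeff ϖ i (k : G O n r) X) :
    coeffHom hϖ hi hir k = Multiplicative.ofAdd (bar X) := by
  obtain ⟨Z, hZ⟩ := IsCoeff.unique hϖ hir.le (exists_coeff hϖ k).choose_spec hX
  change Multiplicative.ofAdd (bar (exists_coeff hϖ k).choose) = _
  rw [hZ, bar_add, bar_smul_pow hϖ (Nat.sub_pos_of_lt hir), add_zero]

/-- `K_i(U)`, the inverse image in `K_i` of the subspace `U` of `M_n(𝔽)` under the homomorphism
`1_n + ϖ^i X (mod 𝔭^r) ↦ X (mod 𝔭)`, as a subgroup of `G_r`. -/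
noncomputable def KU (hϖ : Irreducible ϖ) {i r : ℕ} (hi : 0 < i) (hir : i < r)
    (U : Submodule (IsLocalRing.ResidueField O)
      (Matrix (Fin n) (Fin n) (IsLocalRing.ResidueField O))) : Subgroup (G O n r) :=
  ((AddSubgroup.toSubgroup U.toAddSubgroup).comap (coeffHom hϖ hi hir)).map
    (K O n hir.le).subtype

lemma KU_le (hϖ : Irreducible ϖ) {i r : ℕ} (hi : 0 < i) (hir : i < r)
    (U : Submodule (IsLocalRing.ResidueField O)
      (Matrix (Fin n) (Fin n) (IsLocalRing.ResidueField O))) :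
    KU hϖ hi hir U ≤ K O n hir.le :=
  Subgroup.map_subtype_le _

lemma K_le_KU (hϖ : Irreducible ϖ) {i j r : ℕ} (hi : 0 < i) (hij : i < j) (hjr : j ≤ r)
    (U : Submodule (IsLocalRing.ResidueField O)
      (Matrix (Fin n) (Fin n) (IsLocalRing.ResidueField O))) :
    K O n hjr ≤ KU hϖ hi (hij.trans_le hjr) U := by
  intro k hk
  obtain ⟨X, hX⟩ := exists_coeff hϖ (⟨k, hk⟩ : K O n hjr)
  refine ⟨⟨k, K_anti hij.le hjr hk⟩, ?_, rfl⟩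
  have hX' : IsCoeff ϖ i k (ϖ ^ (j - i) • X) := by
    unfold IsCoeff at *
    rw [smul_smul, ← pow_add, Nat.add_sub_cancel' hij.le]
    exact hX
  change coeffHom hϖ hi (hij.trans_le hjr) _ ∈ AddSubgroup.toSubgroup U.toAddSubgroup
  rw [coeffHom_eq hϖ hi (hij.trans_le hjr) ⟨k, K_anti hij.le hjr hk⟩ hX',
    bar_smul_pow hϖ (Nat.sub_pos_of_lt hij)]
  exact U.zero_mem

end GroupsDVR

/-! ### The character `ψ_β` -/

section PsiBeta

variable {F : Type u} [Field F] [ValuativeRel F] [TopologicalSpace F]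
  [IsNonarchimedeanLocalField F] {n : ℕ}

/-- The value `τ(ϖ^{-m} tr(Xβ))`. -/
noncomputable def tauTrace (ϖ : 𝒪[F]) (τ : AddChar F Circle) (m : ℕ)
    (β X : Matrix (Fin n) (Fin n) 𝒪[F]) : ℂˣ :=
  Circle.toUnits (τ (((ϖ : F) ^ m)⁻¹ * ((X * β).trace : 𝒪[F])))

lemma tauTrace_add (ϖ : 𝒪[F]) (τ : AddChar F Circle) (m : ℕ)
    (β X Y : Matrix (Fin n) (Fin n) 𝒪[F]) :
    tauTrace ϖ τ m β (X + Y) = tauTrace ϖ τ m β X * tauTrace ϖ τ m β Y := by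
  unfold tauTrace
  rw [add_mul, Matrix.trace_add, ← map_mul, ← AddChar.map_add_eq_mul, ← mul_add]
  rfl

lemma tauTrace_smul {ϖ : 𝒪[F]} (hϖ : Irreducible ϖ) {τ : AddChar F Circle}
    (hτ : ∀ x : F, (∀ y : 𝒪[F], τ (x * y) = 1) ↔ x ∈ 𝒪[F]) {m j : ℕ} (hj : m ≤ j)
    (β Z : Matrix (Fin n) (Fin n) 𝒪[F]) :
    tauTrace ϖ τ m β (ϖ ^ j • Z) = 1 := by
  have h0 : (ϖ : F) ≠ 0 := fun h => hϖ.ne_zero (Subtype.ext h)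
  have h1 : ((ϖ : F) ^ m)⁻¹ * (((ϖ ^ j • Z) * β).trace : 𝒪[F]) =
      1 * ((ϖ ^ (j - m) * (Z * β).trace : 𝒪[F]) : F) := by
    rw [Matrix.smul_mul, Matrix.trace_smul, smul_eq_mul, one_mul]
    obtain ⟨d, rfl⟩ := Nat.exists_eq_add_of_le hj
    rw [Nat.add_sub_cancel_left]
    push_cast
    rw [pow_add]
    field_simp
  unfold tauTrace
  rw [h1, (hτ 1).2 (one_mem _), map_one]

/-- The character `ψ_β` of `K_l`, where `l + l' = r` and `l' ≤ l`: it is given by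
`ψ_β(1_n + ϖ^l X (mod 𝔭^r)) = τ(ϖ^{-l'} tr(Xβ))`; see `psiBeta_eq`. -/
noncomputable def psiBeta {ϖ : 𝒪[F]} (hϖ : Irreducible ϖ) {τ : AddChar F Circle}
    (hτ : ∀ x : F, (∀ y : 𝒪[F], τ (x * y) = 1) ↔ x ∈ 𝒪[F])
    {l l' r : ℕ} (hr : l + l' = r) (hl : l' ≤ l) (hlr : l ≤ r)
    (β : Matrix (Fin n) (Fin n) 𝒪[F]) : K 𝒪[F] n hlr →* ℂˣ :=
  MonoidHom.mk' (fun k => tauTrace ϖ τ l' β (exists_coeff hϖ k).choose) (by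
    intro k k'
    obtain ⟨Z, hZ⟩ := IsCoeff.unique hϖ hlr (exists_coeff hϖ (k * k')).choose_spec
      ((exists_coeff hϖ k).choose_spec.mul (exists_coeff hϖ k').choose_spec)
    rw [hZ, tauTrace_add, tauTrace_add, tauTrace_add,
      tauTrace_smul hϖ hτ (show l' ≤ r - l by omega), tauTrace_smul hϖ hτ hl,
      mul_one, mul_one])

lemma psiBeta_eq {ϖ : 𝒪[F]} (hϖ : Irreducible ϖ) {τ : AddChar F Circle}
    (hτ : ∀ x : F, (∀ y : 𝒪[F], τ (x * y) = 1) ↔ x ∈ 𝒪[F])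
    {l l' r : ℕ} (hr : l + l' = r) (hl : l' ≤ l) (hlr : l ≤ r)
    (β : Matrix (Fin n) (Fin n) 𝒪[F]) (k : K 𝒪[F] n hlr)
    {X : Matrix (Fin n) (Fin n) 𝒪[F]} (hX : IsCoeff ϖ l (k : G 𝒪[F] n r) X) :
    psiBeta hϖ hτ hr hl hlr β k =
      Circle.toUnits (τ (((ϖ : F) ^ l')⁻¹ * ((X * β).trace : 𝒪[F]))) := by
  obtain ⟨Z, hZ⟩ := IsCoeff.unique hϖ hlr (exists_coeff hϖ k).choose_spec hX
  change tauTrace ϖ τ l' β (exists_coeff hϖ k).choose = tauTrace ϖ τ l' β X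
  rw [hZ, tauTrace_add, tauTrace_smul hϖ hτ (show l' ≤ r - l by omega), mul_one]

end PsiBeta

/-! ### Representations -/

section Reps

/-- The one-dimensional representation on `ℂ` given by a character. -/
noncomputable def charRep {N : Type*} [Group N] (ψ : N →* ℂˣ) : Representation ℂ N ℂ :=
  (Algebra.lmul ℂ ℂ).toMonoidHom.comp ((Units.coeHom ℂ).comp ψ)

/-- `⟨ψ, A⟩_N = dim Hom_N(ψ, A) > 0`, where `A` is restricted to `N` along `j : N → Γ`. -/
def LiesOver {N Γ : Type u} [Group N] [Group Γ] (j : N →* Γ) (ψ : N →* ℂˣ)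
    (A : Rep.{u} ℂ Γ) : Prop :=
  0 < Module.rank ℂ (Representation.IntertwiningMap (charRep ψ) (Rep.res j A).ρ)

/-- Equivalence classes of complex representations of `Γ`. -/
abbrev RepClass (Γ : Type u) [Group Γ] : Type (u + 1) :=
  Quotient (isIsomorphicSetoid (Rep.{u} ℂ Γ))

/-- The equivalence class of a representation. -/
def repClass {Γ : Type u} [Group Γ] (A : Rep.{u} ℂ Γ) : RepClass Γ :=
  Quotient.mk (isIsomorphicSetoid (Rep.{u} ℂ Γ)) A

/-- `Irr(Γ | ψ)`, the set of equivalence classes of the irreducible complex representations of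
`Γ` lying over `ψ`. -/
def IrrOver {N Γ : Type u} [Group N] [Group Γ] (j : N →* Γ) (ψ : N →* ℂˣ) :
    Set (RepClass Γ) :=
  {c | ∃ A : Rep.{u} ℂ Γ, A.ρ.IsIrreducible ∧ LiesOver j ψ A ∧ repClass A = c}

/-- The representation `χ ⊗ A`, for a character `χ`. -/
noncomputable def charTensor {Γ : Type u} [Group Γ] (χ : Γ →* ℂˣ) (A : Rep.{u} ℂ Γ) :
    Rep.{u} ℂ Γ :=
  Rep.of (Representation.tprod (charRep χ) A.ρ)

/-- A character of `H / H ∩ N`, viewed as a character of `HN` which is trivial on `N`. -/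
noncomputable def inflateChar {Γ : Type u} [Group Γ] (H N : Subgroup Γ) [N.Normal]
    (χ : H ⧸ N.subgroupOf H →* ℂˣ) : (H ⊔ N : Subgroup Γ) →* ℂˣ :=
  (χ.comp (QuotientGroup.quotientInfEquivProdNormalQuotient H N).symm.toMonoidHom).comp
    (QuotientGroup.mk' (N.subgroupOf (H ⊔ N)))

/-- The trivial module `ℂˣ`, lifted to the universe of the group. -/
abbrev unitsCoeff (H : Type u) [Group H] : Rep.{u} (ULift.{u} ℤ) H :=
  Rep.trivial (ULift.{u} ℤ) H (ULift.{u} (Additive ℂˣ))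

/-- Let `A` be a representation of the normal subgroup `N` of `Γ`, and let `H ≤ Γ`. The class
`c ∈ H²(H, ℂˣ)` (trivial action) is a Schur multiplier of `A` if there are operators
`U(ε)`, `ε ∈ H`, on the space of `A` with `A(ε k ε⁻¹) = U(ε) ∘ A(k) ∘ U(ε)⁻¹` for all `k ∈ N`,
and if `c` is the class of the `2`-cocycle `c_U` given by `U(ε) ∘ U(η) = c_U(ε, η) • U(εη)`. -/
def IsSchurMultiplier {Γ : Type u} [Group Γ] (H N : Subgroup Γ) [N.Normal] (A : Rep.{u} ℂ N)
    (c : groupCohomology.H2 (unitsCoeff H)) : Prop :=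
  ∃ (U : H → (A.V ≃ₗ[ℂ] A.V)) (cU : groupCohomology.cocycles₂ (unitsCoeff H)),
    (∀ (ε : H) (k : N), A.ρ (MulAut.conjNormal (ε : Γ) k) =
      (U ε).toLinearMap ∘ₗ A.ρ k ∘ₗ (U ε).symm.toLinearMap) ∧
    (∀ ε η : H, (U ε).toLinearMap ∘ₗ (U η).toLinearMap =
      (((cU (ε, η)).down.toMul : ℂˣ) : ℂ) • (U (ε * η)).toLinearMap) ∧
    c = groupCohomology.H2π (unitsCoeff H) cU

end Reps

/-! ### The objects attached to `β` for `r = 2l - 1`, `l ≥ 2` -/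

section Main

variable {F : Type u} [Field F] [ValuativeRel F] [TopologicalSpace F]
  [IsNonarchimedeanLocalField F]

variable (F) in
/-- The subgroup `K_l` of `G_r`, for `r = 2l - 1`. -/
noncomputable abbrev Kl (n : ℕ) {r l : ℕ} (hl : 2 ≤ l) (hr : r = 2 * l - 1) : Subgroup (G 𝒪[F] n r) :=
  K 𝒪[F] n (i := l) (by omega)

variable (F) in
/-- The subgroup `K_{l-1}` of `G_r`, for `r = 2l - 1`. -/
noncomputable abbrev Kl1 (n : ℕ) {r l : ℕ} (hl : 2 ≤ l) (hr : r = 2 * l - 1) : Subgroup (G 𝒪[F] n r) :=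
  K 𝒪[F] n (i := l - 1) (by omega)

variable {n r l : ℕ}

/-- The subgroup `𝒞 K_{l-1}` of `G_r` (the join, `K_{l-1}` being normal). -/
noncomputable abbrev CK (hl : 2 ≤ l) (hr : r = 2 * l - 1) (β : Matrix (Fin n) (Fin n) 𝒪[F]) :
    Subgroup (G 𝒪[F] n r) :=
  C r β ⊔ Kl1 F n hl hr

/-- The subgroup `K_{l-1}(𝔽[β̄])` of `G_r`. -/
noncomputable abbrev KBeta {ϖ : 𝒪[F]} (hϖ : Irreducible ϖ) (hl : 2 ≤ l) (hr : r = 2 * l - 1)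
    (β : Matrix (Fin n) (Fin n) 𝒪[F]) : Subgroup (G 𝒪[F] n r) :=
  KU hϖ (i := l - 1) (by omega) (by omega) (resAlg β)

lemma Kl_le_KBeta {ϖ : 𝒪[F]} (hϖ : Irreducible ϖ) (hl : 2 ≤ l) (hr : r = 2 * l - 1)
    (β : Matrix (Fin n) (Fin n) 𝒪[F]) : Kl F n hl hr ≤ KBeta hϖ hl hr β :=
  K_le_KU hϖ (by omega) (by omega) (by omega) (resAlg β)

lemma KBeta_le_Kl1 {ϖ : 𝒪[F]} (hϖ : Irreducible ϖ) (hl : 2 ≤ l) (hr : r = 2 * l - 1)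
    (β : Matrix (Fin n) (Fin n) 𝒪[F]) : KBeta hϖ hl hr β ≤ Kl1 F n hl hr :=
  KU_le hϖ (by omega) (by omega) (resAlg β)

/-- The character `ψ_β` of `K_l`; here `l' = l - 1`. -/
noncomputable abbrev psi {ϖ : 𝒪[F]} (hϖ : Irreducible ϖ) {τ : AddChar F Circle}
    (hτ : ∀ x : F, (∀ y : 𝒪[F], τ (x * y) = 1) ↔ x ∈ 𝒪[F])
    (hl : 2 ≤ l) (hr : r = 2 * l - 1) (β : Matrix (Fin n) (Fin n) 𝒪[F]) :
    Kl F n hl hr →* ℂˣ :=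
  psiBeta hϖ hτ (l := l) (l' := l - 1) (by omega) (by omega) (by omega) β

/-- `Y(ψ_β)`, the set of the characters of `K_{l-1}(𝔽[β̄])` whose restriction to `K_l`
is `ψ_β`. -/
def Y {ϖ : 𝒪[F]} (hϖ : Irreducible ϖ) {τ : AddChar F Circle}
    (hτ : ∀ x : F, (∀ y : 𝒪[F], τ (x * y) = 1) ↔ x ∈ 𝒪[F])
    (hl : 2 ≤ l) (hr : r = 2 * l - 1) (β : Matrix (Fin n) (Fin n) 𝒪[F]) :
    Set (KBeta hϖ hl hr β →* ℂˣ) :=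
  {ψ | ψ.comp (Subgroup.inclusion (Kl_le_KBeta hϖ hl hr β)) = psi hϖ hτ hl hr β}

/-- `A` is an irreducible representation of `K_{l-1}` lying over the character `ψ` of
`K_{l-1}(𝔽[β̄])`. -/
def IsPi {ϖ : 𝒪[F]} (hϖ : Irreducible ϖ) (hl : 2 ≤ l) (hr : r = 2 * l - 1)
    (β : Matrix (Fin n) (Fin n) 𝒪[F]) (ψ : KBeta hϖ hl hr β →* ℂˣ)
    (A : Rep.{u} ℂ (Kl1 F n hl hr)) : Prop :=
  A.ρ.IsIrreducible ∧ LiesOver (Subgroup.inclusion (KBeta_le_Kl1 hϖ hl hr β)) ψ A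

/-- The representation `B` of `𝒞 K_{l-1}` is an extension of the representation `A` of
`K_{l-1}`. -/
def IsExtension (hl : 2 ≤ l) (hr : r = 2 * l - 1) (β : Matrix (Fin n) (Fin n) 𝒪[F])
    (A : Rep.{u} ℂ (Kl1 F n hl hr)) (B : Rep.{u} ℂ (CK hl hr β)) : Prop :=
  Nonempty (Rep.res
    (Subgroup.inclusion (le_sup_right : Kl1 F n hl hr ≤ C r β ⊔ Kl1 F n hl hr)) B ≅ A)

/-- The Schur multiplier `c(ψ) ∈ H²(𝒞, ℂˣ)`, i.e. that of the irreducible representation of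
`K_{l-1}` lying over `ψ`, is trivial for every `ψ ∈ Y(ψ_β)`. -/
def SchurHypothesis {ϖ : 𝒪[F]} (hϖ : Irreducible ϖ) {τ : AddChar F Circle}
    (hτ : ∀ x : F, (∀ y : 𝒪[F], τ (x * y) = 1) ↔ x ∈ 𝒪[F])
    (hl : 2 ≤ l) (hr : r = 2 * l - 1) (β : Matrix (Fin n) (Fin n) 𝒪[F]) : Prop :=
  ∀ ψ ∈ Y hϖ hτ hl hr β, ∀ A : Rep.{u} ℂ (Kl1 F n hl hr), IsPi hϖ hl hr β ψ A →
    ∀ c : groupCohomology.H2 (unitsCoeff (C r β)),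
      IsSchurMultiplier (C r β) (Kl1 F n hl hr) A c → c = 0

end Main

end RegChar

/-! The argument is Clifford theory for the character $\psi_\beta$ of $K_l$, combined with a
Heisenberg-type analysis of $K_{l-1}/K_l$.

By nondegeneracy of the trace pairing, $g$ fixes $\psi_\beta$ exactly when it commutes with $\beta$
modulo $\mathfrak p^{l-1}$ (`psiBeta_conj_iff`). Since $\overline\beta$ is regular, such a $g$ is a
polynomial in $\beta$ modulo $\mathfrak p^{l-1}$, so the stabilizer is $\mathcal CK_{l-1}$
(`mem_C_sup_K_iff`).

For $1+\varpi^{l-1}X$ and $1+\varpi^{l-1}Y$ in $K_{l-1}$, the commutator lies in $K_l$ and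
$\psi_\beta$ takes there the value $\tau(\varpi^{-1}\mathrm{tr}(Y(X\beta-\beta X)))$
(`psiBeta_commutator`). The radical of this pairing consists of the $X$ with $\overline X$ commuting
with $\overline\beta$, that is, $\overline X\in\mathbb F[\overline\beta]$, again by regularity. So
each $\psi\in Y(\psi_\beta)$ is stable under $K_{l-1}$ with nondegenerate pairing on the quotient;
the character of an irreducible representation over $\psi$ then vanishes off $K_{l-1}(\mathbb
F[\overline\beta])$, which forces uniqueness of $\pi_\psi$ (`equiv_of_irreducible_over`). No
polarization is chosen, so the residue characteristic plays no role.

Uniqueness makes $\pi_\psi$ stable under $\mathcal C$. A trivial Schur multiplier lets the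
intertwiners be rescaled to a representation of $\mathcal C$. On $\mathcal C\cap K_{l-1}$ it may
differ from $\pi_\psi$ by a character, which extends to the finite abelian group $\mathcal C$ and
can be divided out (`exists_extension_of_representation`).

Finally, induction from the stabilizer preserves irreducibility and is injective (`ind_irreducible`,
`equiv_of_ind_equiv`), and the representations of $\mathcal CK_{l-1}$ containing $\pi_\psi$ are its
twists by characters of the abelian quotient (`exists_twist_map`). All the group theory is done for
an abstract `IsHeisenbergDatum`; `isHeisenbergDatum` supplies the arithmetic. -/

namespace RegChar

/-! ### Irreducible representations of finite groups, without assuming finite dimension -/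

section RepTheory

variable {G : Type*} [Group G] {V W : Type*} [AddCommGroup V] [Module ℂ V] [AddCommGroup W]
  [Module ℂ W] {ρ : Representation ℂ G V} {σ : Representation ℂ G W}

/-- A nonzero invariant subspace of an irreducible representation is everything. -/
lemma mem_of_irreducible (hρ : ρ.IsIrreducible) (p : Submodule ℂ V)
    (hp : ∀ g, ∀ v ∈ p, ρ g v ∈ p) {v : V} (hv : v ∈ p) (hv0 : v ≠ 0) (w : V) : w ∈ p := by
  let q : Subrepresentation ρ := ⟨p, hp⟩
  have hw : w ∈ (⊤ : Subrepresentation ρ) := Submodule.mem_top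
  rcases hρ.eq_bot_or_eq_top q with h | h
  · have hv' : v ∈ q := hv
    rw [h] at hv'
    exact absurd ((Submodule.mem_bot ℂ).1 hv') hv0
  · rw [← h] at hw
    exact hw

lemma irreducible_of_forall_mem [Nontrivial V]
    (h : ∀ p : Submodule ℂ V, (∀ g, ∀ v ∈ p, ρ g v ∈ p) → ∀ v ∈ p, v ≠ 0 → ∀ w, w ∈ p) :
    ρ.IsIrreducible := by
  have hne : (⊥ : Subrepresentation ρ) ≠ ⊤ := by
    intro h
    obtain ⟨v, hv⟩ := exists_ne (0 : V)
    have hw : v ∈ (⊤ : Subrepresentation ρ) := Submodule.mem_top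
    rw [← h] at hw
    exact hv ((Submodule.mem_bot ℂ).1 hw)
  refine { toNontrivial := ⟨_, _, hne⟩, eq_bot_or_eq_top := fun q => ?_ }
  by_cases hq : ∃ v ∈ q, v ≠ 0
  · obtain ⟨v, hv, hv0⟩ := hq
    right
    apply Subrepresentation.toSubmodule_injective
    exact eq_top_iff.2 fun w _ =>
      h q.toSubmodule (fun g v hv => q.apply_mem_toSubmodule g hv) v hv hv0 w
  · left
    apply Subrepresentation.toSubmodule_injective
    push Not at hq
    exact eq_bot_iff.2 fun w hw => (Submodule.mem_bot ℂ).2 (hq w hw)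

lemma nontrivial_of_irreducible (hρ : ρ.IsIrreducible) : Nontrivial V := by
  by_contra h
  rw [not_nontrivial_iff_subsingleton] at h
  obtain ⟨a, b, hab⟩ := hρ.exists_pair_ne
  exact hab (Subrepresentation.toSubmodule_injective (Subsingleton.elim _ _))

lemma equiv_apply_rho (e : ρ.Equiv σ) (g : G) (v : V) : e (ρ g v) = σ g (e v) :=
  e.toIntertwiningMap.isIntertwining ρ σ g v

lemma irreducible_of_linearEquiv (e : V ≃ₗ[ℂ] W) (he : ∀ g v, e (ρ g v) = σ g (e v))
    (hρ : ρ.IsIrreducible) : σ.IsIrreducible := by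
  have := nontrivial_of_irreducible hρ
  have : Nontrivial W := e.symm.toEquiv.nontrivial
  refine irreducible_of_forall_mem fun p hp v hv hv0 w => ?_
  have key := mem_of_irreducible hρ (p.comap e.toLinearMap)
    (fun g x hx => by
      have := hp g _ hx
      change e (ρ g x) ∈ p
      rw [he]
      exact this)
    (v := e.symm v) (by simpa using hv) (by simpa using hv0) (e.symm w)
  simpa using key

lemma irreducible_of_equiv (e : ρ.Equiv σ) (hρ : ρ.IsIrreducible) : σ.IsIrreducible :=
  irreducible_of_linearEquiv e.toLinearEquiv (equiv_apply_rho e) hρ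

/-- The orbit of a nonzero vector is finite and spans an invariant subspace. This makes Schur's
lemma and traces available for arbitrary complex representations. -/
lemma finiteDimensional_of_irreducible [Finite G] (hρ : ρ.IsIrreducible) :
    FiniteDimensional ℂ V := by
  have := nontrivial_of_irreducible hρ
  obtain ⟨v, hv⟩ := exists_ne (0 : V)
  have h := mem_of_irreducible hρ (Submodule.span ℂ (Set.range fun g => ρ g v))
    (fun g w hw => by
      induction hw using Submodule.span_induction with
      | mem x hx =>
        obtain ⟨a, rfl⟩ := hx
        exact Submodule.subset_span ⟨g * a, by simp⟩
      | zero => simp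
      | add x y _ _ hx hy => rw [map_add]; exact add_mem hx hy
      | smul c x _ hx => rw [map_smul]; exact Submodule.smul_mem _ _ hx)
    (v := v) (Submodule.subset_span ⟨1, by simp⟩) hv
  have htop : Submodule.span ℂ (Set.range fun g => ρ g v) = ⊤ := eq_top_iff.2 fun w _ => h w
  exact ⟨htop ▸ Submodule.fg_span (Set.finite_range _)⟩

/-- Schur's lemma. -/
lemma exists_eq_smul_of_commute [Finite G] (hρ : ρ.IsIrreducible) (f : V →ₗ[ℂ] V)
    (hf : ∀ g v, f (ρ g v) = ρ g (f v)) : ∃ c : ℂ, ∀ v, f v = c • v := by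
  have := finiteDimensional_of_irreducible hρ
  have := hρ
  obtain ⟨c, hc⟩ := (Representation.IsIrreducible.algebraMap_intertwiningMap_bijective_of_isAlgClosed
    (ρ := ρ)).2 (f.intertwiningMap_of_isIntertwiningMap ρ ρ hf)
  refine ⟨c, fun v => ?_⟩
  have := congrArg (fun φ : Representation.IntertwiningMap ρ ρ => φ v) hc
  simpa [Algebra.algebraMap_eq_smul_one] using this.symm

lemma equiv_of_irreducible (hρ : ρ.IsIrreducible) (hσ : σ.IsIrreducible) (f : V →ₗ[ℂ] W)
    (hf : ∀ g v, f (ρ g v) = σ g (f v)) {v : V} (hv : f v ≠ 0) :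
    ∃ e : ρ.Equiv σ, ∀ v, e v = f v := by
  have := hρ
  have := hσ
  let F := f.intertwiningMap_of_isIntertwiningMap ρ σ hf
  have hF : Function.Bijective F := by
    refine (Representation.IsIrreducible.bijective_or_eq_zero F).resolve_right fun h => hv ?_
    have := congrArg (fun φ : Representation.IntertwiningMap ρ σ => φ v) h
    exact this
  exact ⟨F.ofBijective hF, fun v => rfl⟩

/-- Every nonzero invariant subspace of a representation of a finite group contains an
irreducible subrepresentation. -/
lemma exists_irreducible_le [Finite G] (p : Submodule ℂ V)
    (hp : ∀ g, ∀ v ∈ p, ρ g v ∈ p) {v : V} (hv : v ∈ p) (hv0 : v ≠ 0) :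
    ∃ q : Subrepresentation ρ, q.toSubmodule ≤ p ∧ q.toRepresentation.IsIrreducible := by
  -- Invertibility of the group order gives semisimplicity (Maschke), hence atomicity of the lattice
  -- of submodules even in infinite dimension.
  have : NeZero (Nat.card G : ℂ) := ⟨by exact_mod_cast Nat.card_pos.ne'⟩
  have hat : IsAtomic (Submodule (MonoidAlgebra ℂ G) ρ.asModule) := inferInstance
  have hat' : IsAtomic (Subrepresentation ρ) :=
    (OrderIso.isAtomic_iff Subrepresentation.subrepresentationSubmoduleOrderIso).2 hat
  let P : Subrepresentation ρ := ⟨p, hp⟩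
  have hP : P ≠ ⊥ := by
    intro h
    have hv' : v ∈ P := hv
    rw [h] at hv'
    exact hv0 ((Submodule.mem_bot ℂ).1 hv')
  obtain ⟨q, hq, hqP⟩ := (hat'.eq_bot_or_exists_atom_le P).resolve_left hP
  refine ⟨q, hqP, ?_⟩
  have hex : ∃ v ∈ q, v ≠ 0 := by
    by_contra h
    push Not at h
    exact hq.1 (Subrepresentation.toSubmodule_injective
      (eq_bot_iff.2 fun w hw => (Submodule.mem_bot ℂ).2 (h w hw)))
  obtain ⟨w, hw, hw0⟩ := hex
  have : Nontrivial q.toSubmodule := ⟨⟨w, hw⟩, 0, fun h => hw0 (congrArg Subtype.val h)⟩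
  refine irreducible_of_forall_mem fun s hs x hx hx0 y => ?_
  let S : Subrepresentation ρ := ⟨s.map q.toSubmodule.subtype, by
    rintro g _ ⟨z, hz, rfl⟩
    exact ⟨_, hs g z hz, rfl⟩⟩
  have hSq : S ≤ q := by
    rintro _ ⟨z, hz, rfl⟩
    exact z.2
  rcases hq.le_iff.1 hSq with h | h
  · have : (x : V) ∈ S := ⟨x, hx, rfl⟩
    rw [h] at this
    exact absurd (Subtype.ext ((Submodule.mem_bot ℂ).1 this)) hx0
  · have : (y : V) ∈ S := by rw [h]; exact y.2
    obtain ⟨z, hz, hzy⟩ := this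
    rwa [← Subtype.ext hzy]

/-- A line stable under a group is the eigenspace of a character. -/
lemma exists_character_of_eigenvector {v : V} (hv : v ≠ 0) (h : ∀ g, ∃ c : ℂ, ρ g v = c • v) :
    ∃ χ : G →* ℂˣ, ∀ g, ρ g v = (χ g : ℂ) • v := by
  choose c hc using h
  have hinj : ∀ a b : ℂ, a • v = b • v → a = b := fun a b => (smul_left_injective ℂ hv).eq_iff.1
  have h1 : c 1 = 1 := hinj _ _ (by rw [← hc]; simp)
  have hm : ∀ g g', c (g * g') = c g * c g' := fun g g' => hinj _ _ (by
    rw [← hc, map_mul, Module.End.mul_apply, hc, map_smul, hc, smul_smul, mul_comm])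
  let f : G →* ℂ := ⟨⟨c, h1⟩, hm⟩
  exact ⟨f.toHomUnits, fun g => hc g⟩

/-- Commuting operators from a finite group have a common eigenvector in every nonzero
invariant subspace. -/
lemma exists_common_eigenvector [Finite G] (p : Submodule ℂ V)
    (hp : ∀ g, ∀ v ∈ p, ρ g v ∈ p) {v : V} (hv : v ∈ p) (hv0 : v ≠ 0)
    (hcomm : ∀ g g', ∀ v ∈ p, ρ g (ρ g' v) = ρ g' (ρ g v)) :
    ∃ χ : G →* ℂˣ, ∃ w ∈ p, w ≠ 0 ∧ ∀ g, ρ g w = (χ g : ℂ) • w := by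
  obtain ⟨q, hqp, hq⟩ := exists_irreducible_le p hp hv hv0
  have := nontrivial_of_irreducible hq
  obtain ⟨w, hw⟩ := exists_ne (0 : q.toSubmodule)
  have hw' : (w : V) ≠ 0 := fun h => hw (Subtype.ext h)
  -- The operators commute on `q`, so each is an endomorphism of an irreducible representation and
  -- therefore a scalar: any nonzero `w` in `q` will do.
  obtain ⟨χ, hχ⟩ := exists_character_of_eigenvector (ρ := ρ) hw' fun g => by
    obtain ⟨c, hc⟩ := exists_eq_smul_of_commute hq (q.toRepresentation g)
      (fun g' x => Subtype.ext (hcomm g g' x (hqp x.2)))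
    exact ⟨c, congrArg Subtype.val (hc w)⟩
  exact ⟨χ, w, hqp w.2, hw', hχ⟩

/-- An intertwiner out of a one-dimensional representation is determined by the image of $1$, which
is an eigenvector. -/
lemma liesOver_iff {N Γ : Type u} [Group N] [Group Γ] (j : N →* Γ) (ψ : N →* ℂˣ)
    (A : Rep.{u} ℂ Γ) :
    LiesOver j ψ A ↔ ∃ v : A.V, v ≠ 0 ∧ ∀ x, A.ρ (j x) v = (ψ x : ℂ) • v := by
  unfold LiesOver
  rw [rank_pos_iff_nontrivial]
  constructor
  · rintro h
    obtain ⟨f, hf⟩ := exists_ne (0 : Representation.IntertwiningMap (charRep ψ) (Rep.res j A).ρ)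
    refine ⟨f (1 : ℂ), fun h => hf ?_, fun x => ?_⟩
    · apply Representation.IntertwiningMap.ext
      exact LinearMap.ext_ring h
    · refine (f.isIntertwining _ _ x (1 : ℂ)).symm.trans ?_
      have : charRep ψ x (1 : ℂ) = (ψ x : ℂ) • (1 : ℂ) := by simp [charRep]
      rw [this, map_smul]
  · rintro ⟨v, hv, h⟩
    have hf : ∀ (x : N) (c : ℂ), LinearMap.toSpanSingleton ℂ A.V v (charRep ψ x c) =
        (Rep.res j A).ρ x (LinearMap.toSpanSingleton ℂ A.V v c) := by
      intro x c
      have h' : (Rep.res j A).ρ x v = (ψ x : ℂ) • v := h x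
      simp only [LinearMap.toSpanSingleton_apply]
      rw [map_smul, h']
      simp [charRep, smul_smul, mul_comm]
    refine ⟨⟨(LinearMap.toSpanSingleton ℂ A.V v).intertwiningMap_of_isIntertwiningMap _ _ hf, 0,
      fun h0 => hv ?_⟩⟩
    have := congrArg (fun φ : Representation.IntertwiningMap (charRep ψ) (Rep.res j A).ρ =>
      φ (1 : ℂ)) h0
    simpa using this

lemma repClass_eq_iff {Γ : Type u} [Group Γ] {A B : Rep.{u} ℂ Γ} :
    repClass A = repClass B ↔ Nonempty (A.ρ.Equiv B.ρ) := by
  unfold repClass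
  rw [Quotient.eq]
  exact ⟨fun ⟨i⟩ => ⟨Representation.equivOfIso i⟩, fun ⟨e⟩ => ⟨Rep.mkIso e⟩⟩

end RepTheory


/-! ### Existence and uniqueness of the irreducible representation over a stable character -/

section Heisenberg

variable {P N : Type*} [Group P] [Group N] {j : P →* N} {ψ : P →* ℂˣ}

/-- Stability of `ψ` under conjugation makes the `ψ`-eigenspace invariant under all of `N`, so
irreducibility makes it the whole space. -/
lemma central_of_irreducible
    (hc : ∀ (n : N) (x : P), ∃ x' : P, n⁻¹ * j x * n = j x' ∧ ψ x' = ψ x)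
    {V : Type*} [AddCommGroup V] [Module ℂ V] {ρ : Representation ℂ N V} (hρ : ρ.IsIrreducible)
    {v : V} (hv : v ≠ 0) (hψ : ∀ x, ρ (j x) v = (ψ x : ℂ) • v) (x : P) (w : V) :
    ρ (j x) w = (ψ x : ℂ) • w := by
  let p : Submodule ℂ V :=
    { carrier := {w | ∀ x, ρ (j x) w = (ψ x : ℂ) • w}
      add_mem' := fun ha hb x => by rw [map_add, ha x, hb x, smul_add]
      zero_mem' := fun x => by simp
      smul_mem' := fun c w hw x => by rw [map_smul, hw x, smul_comm] }
  refine mem_of_irreducible hρ p (fun n w hw x => ?_) (v := v) hψ hv w x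
  obtain ⟨x', hx', hψx'⟩ := hc n x
  have h1 : j x * n = n * j x' := by rw [← hx']; group
  rw [← Module.End.mul_apply, ← map_mul, h1, map_mul, Module.End.mul_apply, hw x', map_smul, hψx']

/-- If `ψ` is a stable character for which the commutator pairing is nondegenerate, then any two
irreducible representations lying over `ψ` are isomorphic. -/
lemma equiv_of_irreducible_over [Finite N]
    (hc : ∀ (n : N) (x : P), ∃ x' : P, n⁻¹ * j x * n = j x' ∧ ψ x' = ψ x)
    (hn : ∀ n : N, n ∉ j.range → ∃ (m : N) (x : P), m * n * m⁻¹ = j x * n ∧ ψ x ≠ 1)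
    {V W : Type*} [AddCommGroup V] [Module ℂ V] [AddCommGroup W] [Module ℂ W]
    {ρ : Representation ℂ N V} {σ : Representation ℂ N W}
    (hρ : ρ.IsIrreducible) (hσ : σ.IsIrreducible)
    {v : V} (hv : v ≠ 0) (hψ : ∀ x, ρ (j x) v = (ψ x : ℂ) • v)
    {w : W} (hw : w ≠ 0) (hψ' : ∀ x, σ (j x) w = (ψ x : ℂ) • w) : Nonempty (ρ.Equiv σ) := by
  classical
  have := Fintype.ofFinite N
  have := finiteDimensional_of_irreducible hρ
  have := finiteDimensional_of_irreducible hσ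
  have := nontrivial_of_irreducible hρ
  have := nontrivial_of_irreducible hσ
  have hcard : (Nat.card N : ℂ) ≠ 0 := by exact_mod_cast Nat.card_pos.ne'
  have : Invertible (Nat.card N : ℂ) := invertibleOfNonzero hcard
  have hcρ := central_of_irreducible hc hρ hv hψ
  have hcσ := central_of_irreducible hc hσ hw hψ'
  -- Conjugating `n` by a suitable `m` multiplies the trace by $\psi(x)\ne1$, while the trace is a
  -- class function.
  have hzero : ∀ n : N, n ∉ j.range → σ.character n = 0 := by
    intro n hnr
    obtain ⟨m, x, hmx, hx⟩ := hn n hnr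
    have h1 : σ.character n = (ψ x : ℂ) * σ.character n := by
      have h2 : σ (j x) = (ψ x : ℂ) • LinearMap.id := LinearMap.ext (hcσ x)
      conv_lhs => rw [← Representation.char_conj σ n m, hmx]
      unfold Representation.character
      rw [map_mul, h2, show ((ψ x : ℂ) • LinearMap.id) * σ n = (ψ x : ℂ) • σ n from rfl, map_smul,
        smul_eq_mul]
    have h3 : (1 - (ψ x : ℂ)) * σ.character n = 0 := by rw [sub_mul, one_mul, ← h1, sub_self]
    refine (mul_eq_zero.1 h3).resolve_left fun h4 => hx ?_
    exact Units.ext (by simpa using (sub_eq_zero.1 h4).symm)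
  -- On the image of `P` both representations are scalar and the scalars cancel, so the character
  -- inner product is a sum of equal positive terms. Hence nonzero intertwiners exist.
  have hval : ∀ n : N, n ∈ j.range → σ.character n * ρ.character n⁻¹ =
      (Module.finrank ℂ W : ℂ) * Module.finrank ℂ V := by
    rintro _ ⟨x, rfl⟩
    have h2 : σ (j x) = (ψ x : ℂ) • LinearMap.id := LinearMap.ext (hcσ x)
    have h3 : ρ (j x)⁻¹ = (ψ x⁻¹ : ℂ) • LinearMap.id := by
      rw [← map_inv]; exact LinearMap.ext (hcρ x⁻¹)
    unfold Representation.character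
    rw [h2, h3, map_smul, map_smul, LinearMap.trace_id, LinearMap.trace_id, map_inv]
    simp only [smul_eq_mul]
    rw [mul_mul_mul_comm, Units.mul_inv, one_mul]
  have hsum := Representation.card_inv_mul_sum_char_mul_char_eq_finrank ρ σ
  have hs : ∑ n : N, σ.character n * ρ.character n⁻¹ =
      ∑ n : N, if n ∈ j.range then (Module.finrank ℂ W : ℂ) * Module.finrank ℂ V else 0 := by
    refine Finset.sum_congr rfl fun n _ => ?_
    split_ifs with h
    · exact hval n h
    · rw [hzero n h, zero_mul]
  rw [hs, ← Finset.sum_filter, Finset.sum_const, nsmul_eq_mul] at hsum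
  have hpos : Module.finrank ℂ (Representation.IntertwiningMap ρ σ) ≠ 0 := by
    intro h0
    rw [h0, Nat.cast_zero] at hsum
    have hf1 : (Module.finrank ℂ W : ℂ) ≠ 0 := by exact_mod_cast Module.finrank_pos.ne'
    have hf2 : (Module.finrank ℂ V : ℂ) ≠ 0 := by exact_mod_cast Module.finrank_pos.ne'
    have hf3 : ((Finset.univ.filter fun n : N => n ∈ j.range).card : ℂ) ≠ 0 := by
      have : (1 : N) ∈ Finset.univ.filter fun n : N => n ∈ j.range := by
        simpa using ⟨1, map_one j⟩
      exact_mod_cast (Finset.card_pos.2 ⟨_, this⟩).ne'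
    exact mul_ne_zero (inv_ne_zero hcard) (mul_ne_zero hf3 (mul_ne_zero hf1 hf2)) hsum
  have hnt : Nontrivial (Representation.IntertwiningMap ρ σ) :=
    Module.nontrivial_of_finrank_pos (R := ℂ) (Nat.pos_of_ne_zero hpos)
  obtain ⟨f, hf⟩ := exists_ne (0 : Representation.IntertwiningMap ρ σ)
  obtain ⟨x, hx⟩ : ∃ x, f x ≠ 0 := by
    by_contra h
    push Not at h
    exact hf (Representation.IntertwiningMap.ext (LinearMap.ext h))
  obtain ⟨e, -⟩ := equiv_of_irreducible hρ hσ f.toLinearMap (f.isIntertwining ρ σ) hx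
  exact ⟨e⟩

end Heisenberg

/-- An irreducible representation lying over a stable character exists. -/
lemma exists_irreducible_over {P N : Type u} [Group P] [Group N] [Finite N] {j : P →* N}
    {ψ : P →* ℂˣ} (hj : Function.Injective j)
    (hc : ∀ (n : N) (x : P), ∃ x' : P, n⁻¹ * j x * n = j x' ∧ ψ x' = ψ x) :
    ∃ A : Rep.{u} ℂ N, A.ρ.IsIrreducible ∧ LiesOver j ψ A := by
  classical
  let R : Representation ℂ N (N → ℂ) :=
    { toFun := fun n => LinearMap.funLeft ℂ ℂ (fun y => y * n)
      map_one' := by ext; simp [LinearMap.funLeft]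
      map_mul' := fun a b => by
        refine LinearMap.ext fun f => funext fun y => ?_
        simp [LinearMap.funLeft, mul_assoc] }
  have hR : ∀ n f y, R n f y = f (y * n) := fun n f y => rfl
  -- The induced space in its function model. Stability of `ψ` makes it invariant under right
  -- translation, and the defining equation says that every element is a `ψ`-eigenvector.
  let p : Submodule ℂ (N → ℂ) :=
    { carrier := {f | ∀ x y, f (y * j x) = (ψ x : ℂ) * f y}
      add_mem' := fun ha hb x y => by simp [ha x y, hb x y, mul_add]
      zero_mem' := fun x => by simp
      smul_mem' := fun c f hf x y => by simp [hf x y, mul_left_comm] }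
  have hp : ∀ n, ∀ f ∈ p, R n f ∈ p := by
    intro n f hf x y
    obtain ⟨x', hx', hψ⟩ := hc n x
    rw [hR, hR, ← hψ, ← hf x', ← hx']
    congr 1
    group
  -- The character extended by zero shows that `p` is nonzero; injectivity of `j` makes it well
  -- defined.
  let f₀ : N → ℂ := fun y => if h : ∃ x, j x = y then (ψ h.choose : ℂ) else 0
  have hf₀ : ∀ x, f₀ (j x) = ψ x := by
    intro x
    have h : ∃ x', j x' = j x := ⟨x, rfl⟩
    change (if h : ∃ x', j x' = j x then (ψ h.choose : ℂ) else 0) = ψ x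
    rw [dif_pos h, hj h.choose_spec]
  have hf₀p : f₀ ∈ p := by
    intro x y
    by_cases h : ∃ x', j x' = y
    · obtain ⟨x', rfl⟩ := h
      rw [← map_mul, hf₀, hf₀, map_mul, mul_comm]
      simp
    · have h' : ¬ ∃ x', j x' = y * j x := by
        rintro ⟨x', hx'⟩
        exact h ⟨x' * x⁻¹, by rw [map_mul, hx', map_inv]; group⟩
      change (if h : ∃ x', j x' = y * j x then (ψ h.choose : ℂ) else 0) =
        (ψ x : ℂ) * (if h : ∃ x', j x' = y then (ψ h.choose : ℂ) else 0)
      rw [dif_neg h, dif_neg h', mul_zero]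
  have hf₀0 : f₀ ≠ 0 := by
    intro h
    have := hf₀ 1
    rw [h] at this
    simp at this
  obtain ⟨q, hqp, hq⟩ := exists_irreducible_le p hp hf₀p hf₀0
  refine ⟨Rep.of q.toRepresentation, hq, (liesOver_iff _ _ _).2 ?_⟩
  have := nontrivial_of_irreducible hq
  obtain ⟨v, hv⟩ := exists_ne (0 : q.toSubmodule)
  refine ⟨v, hv, fun x => Subtype.ext (funext fun y => ?_)⟩
  exact hqp v.2 x y


/-! ### Extending a stable representation when the Schur multiplier vanishes -/

section Extension

variable {G : Type u} [Group G] {C N : Subgroup G} [N.Normal]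

/-- A representation of `N` and a compatible representation of `C` on the same space glue to a
representation of `CN`. -/
lemma exists_glue {V : Type*} [AddCommGroup V] [Module ℂ V]
    (A : Representation ℂ N V) (U : Representation ℂ C V)
    (hconj : ∀ (ε : C) (k : N), A (MulAut.conjNormal (ε : G) k) * U ε = U ε * A k)
    (hagree : ∀ (ε : C) (h : (ε : G) ∈ N), U ε = A ⟨ε, h⟩) :
    ∃ B : Representation ℂ (C ⊔ N : Subgroup G) V,
      ∀ k : N, B (Subgroup.inclusion le_sup_right k) = A k := by
  have hwd : ∀ (c c' : C) (n n' : N), (c * n : G) = c' * n' → U c * A n = U c' * A n' := by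
    intro c c' n n' h
    have h1 : ((c'⁻¹ * c : C) : G) = ((n' * n⁻¹ : N) : G) := by
      push_cast
      rw [eq_mul_inv_iff_mul_eq, mul_assoc, h, inv_mul_cancel_left]
    have h2 : U (c'⁻¹ * c) = A (n' * n⁻¹) := by
      rw [hagree _ (by rw [h1]; exact SetLike.coe_mem _)]
      congr 1
      exact Subtype.ext h1
    rw [← mul_inv_cancel_left c' c, map_mul, h2, mul_assoc, ← map_mul, inv_mul_cancel_right]
  have hdec : ∀ t : (C ⊔ N : Subgroup G), ∃ p : C × N, (p.1 * p.2 : G) = t := by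
    rintro ⟨t, ht⟩
    obtain ⟨c, hc, n, hn, rfl⟩ := Subgroup.mem_sup_of_normal_right.1 ht
    exact ⟨(⟨c, hc⟩, ⟨n, hn⟩), rfl⟩
  choose p hp using hdec
  have key : ∀ (t : (C ⊔ N : Subgroup G)) (c : C) (n : N), (c * n : G) = t →
      U (p t).1 * A (p t).2 = U c * A n := fun t c n h => hwd _ _ _ _ ((hp t).trans h.symm)
  refine ⟨⟨⟨fun t => U (p t).1 * A (p t).2, ?_⟩, ?_⟩, fun k => ?_⟩
  · rw [key 1 1 1 (by simp), map_one, map_one, mul_one]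
  · intro s t
    -- With $s=c_sn_s$ and $t=c_tn_t$, this moves $A(n_s)$ past $U(c_t)$, following
    -- $st=c_sc_t\cdot(c_t^{-1}n_sc_t)n_t$.
    have hcn := hconj (p t).1 (MulAut.conjNormal ((p t).1 : G)⁻¹ (p s).2)
    rw [← MulAut.mul_apply, ← map_mul, mul_inv_cancel, map_one, MulAut.one_apply] at hcn
    change U (p (s * t)).1 * A (p (s * t)).2 = _ * _
    rw [key (s * t) ((p s).1 * (p t).1) (MulAut.conjNormal ((p t).1 : G)⁻¹ (p s).2 * (p t).2) ?_]
    · change _ = (U (p s).1 * A (p s).2) * (U (p t).1 * A (p t).2)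
      rw [map_mul, map_mul, mul_assoc, mul_assoc, ← mul_assoc (A (p s).2), hcn, mul_assoc]
    · rw [show ((s * t : (C ⊔ N : Subgroup G)) : G) = s * t from rfl, ← hp s, ← hp t]
      push_cast [MulAut.conjNormal_apply]
      group
  · change U _ * A _ = A k
    rw [key _ 1 k (by simp), map_one, one_mul]

/-- If the operators implementing the action of the abelian group `C` on an irreducible
representation `A` of `N` form a representation of `C`, then `A` extends to `CN`. -/
lemma exists_extension_of_representation [Finite G] (hC : ∀ a ∈ C, ∀ b ∈ C, a * b = b * a)
    {V : Type*} [AddCommGroup V] [Module ℂ V]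
    {A : Representation ℂ N V} (hA : A.IsIrreducible) (U : Representation ℂ C V)
    (hconj : ∀ (ε : C) (k : N), A (MulAut.conjNormal (ε : G) k) * U ε = U ε * A k) :
    ∃ B : Representation ℂ (C ⊔ N : Subgroup G) V,
      ∀ k : N, B (Subgroup.inclusion le_sup_right k) = A k := by
  let S : Subgroup C := N.subgroupOf C
  let i : S →* N := (C.subtype.comp S.subtype).codRestrict N (fun x => x.2)
  have := nontrivial_of_irreducible hA
  have hid : (LinearMap.id : V →ₗ[ℂ] V) ≠ 0 := one_ne_zero (α := Module.End ℂ V)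
  -- For $s\in C\cap N$ both $U(s)$ and $A(s)$ implement conjugation by $s$, so $U(s)A(s)^{-1}$ is
  -- scalar. Viewing the identity as an eigenvector of $f\mapsto U(s)fA(s)^{-1}$ shows that the
  -- scalars form a character.
  obtain ⟨lam, hlam⟩ := exists_character_of_eigenvector
    (ρ := Representation.linHom (A.comp i) (U.comp S.subtype)) hid fun s => by
      obtain ⟨c, hc⟩ := exists_eq_smul_of_commute hA (U s * A (i s)⁻¹) fun k v => by
        have h1 : U s * A (i s)⁻¹ * A k = A k * (U s * A (i s)⁻¹) := by
          have h2 := hconj s ((i s)⁻¹ * k * i s)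
          rw [show MulAut.conjNormal ((s : C) : G) ((i s)⁻¹ * k * i s) = k from Subtype.ext (by
            rw [MulAut.conjNormal_apply]
            change ((s : C) : G) * (((s : C) : G)⁻¹ * k * ((s : C) : G)) * ((s : C) : G)⁻¹ = k
            group)] at h2
          rw [← mul_assoc, h2, map_mul, map_mul, mul_assoc, mul_assoc, mul_assoc, mul_assoc,
            ← map_mul A (i s), mul_inv_cancel, map_one, mul_one]
        exact congrArg (fun f : V →ₗ[ℂ] V => f v) h1
      refine ⟨c, LinearMap.ext fun v => ?_⟩
      exact (hc v)
  let _ : CommGroup C := { (inferInstance : Group C) with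
    mul_comm := fun a b => Subtype.ext (hC a a.2 b b.2) }
  have : NeZero (Monoid.exponent C) := ⟨Monoid.exponent_ne_zero_of_finite⟩
  -- Characters of a subgroup of a finite abelian group extend; dividing `U` by the extension keeps
  -- the conjugation relation and gives agreement with `A` on $C\cap N$.
  obtain ⟨χ, hχ⟩ := MonoidHom.domRestrict_surjective ℂ (G := C) S lam
  let U' : Representation ℂ C V :=
    { toFun := fun ε => ((χ ε)⁻¹ : ℂˣ) • U ε
      map_one' := by simp
      map_mul' := fun a b => by
        rw [map_mul, mul_inv, map_mul, smul_mul_smul_comm] }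
  have hU' : ∀ ε, U' ε = ((χ ε)⁻¹ : ℂˣ) • U ε := fun ε => rfl
  refine exists_glue A U' (fun ε k => ?_) fun ε h => ?_
  · rw [hU', mul_smul_comm, hconj, smul_mul_assoc]
  · have h1 := hlam ⟨ε, h⟩
    have h2 : χ ε = lam ⟨ε, h⟩ := by rw [← hχ]; rfl
    have h3 : U ε * A (i ⟨ε, h⟩)⁻¹ = (lam ⟨ε, h⟩ : ℂ) • 1 := h1
    have h4 : U ε = (lam ⟨ε, h⟩ : ℂ) • A (i ⟨ε, h⟩) := by
      calc U ε = U ε * A (i ⟨ε, h⟩)⁻¹ * A (i ⟨ε, h⟩) := by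
            rw [mul_assoc, ← map_mul, inv_mul_cancel, map_one, mul_one]
        _ = _ := by rw [h3, smul_mul_assoc, one_mul]
    rw [hU', h4, h2, Units.smul_def, smul_smul, Units.inv_mul, one_smul]
    rfl

/-- By Schur's lemma the implementing operators multiply up to scalars, which form a 2-cocycle by
associativity. Its triviality provides the factors that turn the operators into a representation of
`C`. -/
lemma exists_extension_of_schurMultiplier [Finite G] (hC : ∀ a ∈ C, ∀ b ∈ C, a * b = b * a)
    (A : Rep.{u} ℂ N) (hA : A.ρ.IsIrreducible)
    (hstab : ∀ ε : C, ∃ U : A.V ≃ₗ[ℂ] A.V, ∀ k : N, ∀ v,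
      A.ρ (MulAut.conjNormal (ε : G) k) (U v) = U (A.ρ k v))
    (hyp : ∀ c : groupCohomology.H2 (unitsCoeff C), IsSchurMultiplier C N A c → c = 0) :
    ∃ B : Representation ℂ (C ⊔ N : Subgroup G) A.V,
      ∀ k : N, B (Subgroup.inclusion le_sup_right k) = A.ρ k := by
  have := nontrivial_of_irreducible hA
  choose U hU using hstab
  have hsc : ∀ ε η : C, ∃ c : ℂˣ, ∀ v, U ε (U η v) = c • U (ε * η) v := by
    intro ε η
    obtain ⟨c, hc⟩ := exists_eq_smul_of_commute hA
      ((U (ε * η)).symm.toLinearMap ∘ₗ (U ε).toLinearMap ∘ₗ (U η).toLinearMap) fun k v => by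
        simp only [LinearMap.comp_apply, LinearEquiv.coe_coe]
        rw [LinearEquiv.symm_apply_eq, ← hU, ← hU, ← hU, LinearEquiv.apply_symm_apply,
          ← MulAut.mul_apply, ← map_mul]
        rfl
    have hc0 : c ≠ 0 := by
      rintro rfl
      obtain ⟨v, hv⟩ := exists_ne (0 : A.V)
      have := hc v
      simp at this
      exact hv this
    refine ⟨Units.mk0 c hc0, fun v => ?_⟩
    have := hc v
    simp only [LinearMap.comp_apply, LinearEquiv.coe_coe] at this
    rw [LinearEquiv.symm_apply_eq, map_smul] at this
    exact this
  choose c hc using hsc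
  obtain ⟨v₀, hv₀⟩ := exists_ne (0 : A.V)
  have hne : ∀ (ε : C) (a b : ℂˣ), a • U ε v₀ = b • U ε v₀ → a = b := by
    intro ε a b h
    refine Units.ext (smul_left_injective ℂ ?_ h)
    simpa using hv₀
  let f : C × C → unitsCoeff C := fun p => ULift.up (Additive.ofMul (c p.1 p.2))
  have hf : f ∈ groupCohomology.cocycles₂ (unitsCoeff C) := by
    rw [groupCohomology.mem_cocycles₂_iff]
    intro g h j
    refine ULift.ext _ _ ?_
    change Additive.ofMul (c (g * h) j * c g h) = Additive.ofMul (c h j * c g (h * j))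
    congr 1
    refine hne (g * h * j) _ _ ?_
    rw [mul_comm, mul_smul, ← hc, ← hc, hc, mul_smul, mul_assoc, ← hc]
    rw [hc h j, Units.smul_def, map_smul, hc, Units.smul_def]
    rfl
  have h0 := hyp _ ⟨U, ⟨f, hf⟩, fun ε k => LinearMap.ext fun v => by
      simp only [LinearMap.comp_apply, LinearEquiv.coe_coe]
      rw [← hU, LinearEquiv.apply_symm_apply],
    fun ε η => LinearMap.ext fun v => hc ε η v, rfl⟩
  rw [groupCohomology.H2π_eq_zero_iff] at h0
  obtain ⟨x, hx⟩ := h0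
  -- The cochain whose coboundary is the cocycle: $y(g)^{-1}U(g)$ is multiplicative.
  let y : C → ℂˣ := fun g => (x g).down.toMul
  have hy : ∀ g h, c g h = y h * (y (g * h))⁻¹ * y g := by
    intro g h
    have h1 := congrFun hx (g, h)
    rw [groupCohomology.d₁₂_hom_apply] at h1
    have h2 := congrArg (fun z : unitsCoeff C => z.down.toMul) h1
    refine Eq.trans h2.symm ?_
    rw [← div_eq_mul_inv]
    rfl
  let U' : C →* (A.V ≃ₗ[ℂ] A.V) := MonoidHom.mk'
    (fun g => (U g).trans (LinearEquiv.smulOfUnit (y g)⁻¹)) fun g h => LinearEquiv.ext fun v => by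
      change (y (g * h))⁻¹ • U (g * h) v = (y g)⁻¹ • U g ((y h)⁻¹ • U h v)
      rw [Units.smul_def (y h)⁻¹, map_smul, ← Units.smul_def, hc, hy, smul_smul, smul_smul]
      congr 1
      rw [mul_comm (y h), mul_comm]
      group
  refine exists_extension_of_representation hC hA
    (LinearEquiv.automorphismGroup.toLinearMapMonoidHom.comp U') fun ε k =>
      LinearMap.ext fun v => ?_
  change A.ρ _ ((y ε)⁻¹ • U ε v) = (y ε)⁻¹ • U ε (A.ρ k v)
  rw [← hU, Units.smul_def, map_smul, Units.smul_def]

end Extension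

/-! ### Induction from the stabilizer of a character of a normal subgroup -/

section Induced

open Representation

variable {G : Type*} [Group G] {T : Subgroup G} {W : Type*} [AddCommGroup W] [Module ℂ W]
  {σ : Representation ℂ T W}

lemma indV_mk_mul (t : T) (h : G) (w : W) :
    IndV.mk T.subtype σ (t * h) w = IndV.mk T.subtype σ h (σ t⁻¹ w) := by
  simp

lemma indV_span {p : Submodule ℂ (IndV T.subtype σ)}
    (h : ∀ g w, IndV.mk T.subtype σ g w ∈ p) (x : IndV T.subtype σ) : x ∈ p := by
  have h0 : p.mkQ = 0 := IndV.hom_ext _ _ fun g => LinearMap.ext fun w => by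
    have := h g w
    simpa using this
  rw [← Submodule.ker_mkQ p, h0]
  simp

/-- Project onto the part supported on the coset of the identity: the class of $(h,w)$ goes to
$\sigma(h)^{-1}w$ for $h\in T$ and to $0$ otherwise. In particular `W` embeds in the induced space.
-/
lemma exists_indV_retraction (σ : Representation ℂ T W) :
    ∃ π : IndV T.subtype σ →ₗ[ℂ] W, ∀ w, π (IndV.mk T.subtype σ 1 w) = w := by
  classical
  let F : G → W →ₗ[ℂ] W := fun h => if ht : h ∈ T then σ ⟨h, ht⟩⁻¹ else 0
  have hF : ∀ (t : T) (h : G), F (t * h) ∘ₗ σ t = F h := by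
    intro t h
    by_cases ht : h ∈ T
    · have ht' : (t * h : G) ∈ T := mul_mem t.2 ht
      simp only [F, dif_pos ht, dif_pos ht']
      rw [← Module.End.mul_eq_comp, ← map_mul]
      congr 1
      rw [inv_mul_eq_iff_eq_mul, eq_mul_inv_iff_mul_eq]
      rfl
    · have ht' : ¬ (t * h : G) ∈ T := fun h' => ht ((T.mul_mem_cancel_left t.2).1 h')
      simp only [F, dif_neg ht, dif_neg ht', LinearMap.zero_comp]
  refine ⟨Coinvariants.lift _ (TensorProduct.lift <| (Finsupp.lift _ _ _ F) ∘ₗ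
      (MonoidAlgebra.coeffLinearEquiv ℂ).toLinearMap) fun t => ?_, fun w => ?_⟩
  · ext h w
    have := congrArg (fun f : W →ₗ[ℂ] W => f w) (hF t h)
    simpa using this
  · have h1 : (⟨1, T.one_mem⟩ : T) = 1 := rfl
    simp [F, T.one_mem, h1]

variable {M : Subgroup G} [M.Normal] {θ : M →* ℂˣ}

lemma ind_apply_normal (hMT : M ≤ T)
    (hW : ∀ (m : M) w, σ (Subgroup.inclusion hMT m) w = (θ m : ℂ) • w) (m : M) (h : G) (w : W) :
    ind T.subtype σ m (IndV.mk T.subtype σ h w) =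
      (θ (MulAut.conjNormal h m) : ℂ) • IndV.mk T.subtype σ h w := by
  rw [ind_mk]
  have h1 : h * (m : G)⁻¹ = ((Subgroup.inclusion hMT (MulAut.conjNormal h m))⁻¹ : T) * h := by
    push_cast
    rw [Subgroup.coe_inclusion, MulAut.conjNormal_apply]
    group
  rw [h1, indV_mk_mul, inv_inv, hW, map_smul]

/-- The normal subgroup acts on the translate labelled by `h` through the conjugate character
$\theta^h$, and `T` is the stabilizer of `θ`; this is orthogonality of characters of `M`. -/
lemma sum_theta_ind [Fintype M] (hT : ∀ g, g ∈ T ↔ ∀ m, θ (MulAut.conjNormal g m) = θ m)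
    (hMT : M ≤ T) (hW : ∀ (m : M) w, σ (Subgroup.inclusion hMT m) w = (θ m : ℂ) • w)
    (h : G) (w : W) :
    (h ∈ T → ∑ m : M, ((θ m)⁻¹ : ℂˣ) • ind T.subtype σ m (IndV.mk T.subtype σ h w) =
      (Fintype.card M : ℂ) • IndV.mk T.subtype σ h w) ∧
    (h ∉ T → ∑ m : M, ((θ m)⁻¹ : ℂˣ) • ind T.subtype σ m (IndV.mk T.subtype σ h w) = 0) := by
  have h1 : ∑ m : M, ((θ m)⁻¹ : ℂˣ) • ind T.subtype σ m (IndV.mk T.subtype σ h w) =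
      (∑ m : M, (((θ m)⁻¹ * θ (MulAut.conjNormal h m) : ℂˣ) : ℂ)) • IndV.mk T.subtype σ h w := by
    rw [Finset.sum_smul]
    refine Finset.sum_congr rfl fun m _ => ?_
    rw [ind_apply_normal hMT hW, Units.smul_def, smul_smul, Units.val_mul]
  rw [h1]
  constructor
  · intro hh
    congr 1
    rw [Finset.sum_congr rfl fun m _ => by rw [(hT h).1 hh m, inv_mul_cancel]]
    simp
  · intro hh
    let f : M →* ℂ := (Units.coeHom ℂ).comp
      (θ⁻¹ * θ.comp (MulAut.conjNormal h : MulAut M).toMonoidHom)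
    have hf : f ≠ 1 := by
      intro hf
      refine hh ((hT h).2 fun m => ?_)
      have h2 : (((θ m)⁻¹ * θ (MulAut.conjNormal h m) : ℂˣ) : ℂ) = 1 :=
        congrArg (fun f : M →* ℂ => f m) hf
      exact (inv_mul_eq_one.1 (Units.ext h2)).symm
    have h3 : ∑ m : M, (((θ m)⁻¹ * θ (MulAut.conjNormal h m) : ℂˣ) : ℂ) = 0 :=
      sum_hom_units_eq_zero f hf
    rw [h3, zero_smul]

/-- The `θ`-eigenspace of `M` in a representation induced from the stabilizer of `θ`. -/
lemma mem_range_of_eigenvector [Finite G]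
    (hT : ∀ g, g ∈ T ↔ ∀ m, θ (MulAut.conjNormal g m) = θ m)
    (hMT : M ≤ T) (hW : ∀ (m : M) w, σ (Subgroup.inclusion hMT m) w = (θ m : ℂ) • w)
    {x : IndV T.subtype σ} (hx : ∀ m : M, ind T.subtype σ m x = (θ m : ℂ) • x) :
    ∃ w, IndV.mk T.subtype σ 1 w = x := by
  classical
  have := Fintype.ofFinite M
  -- The averaged vectors lie in the copy of `W`: averaging kills every translate outside `T`, and a
  -- translate by an element of `T` is absorbed into `W`.
  have h1 : ∀ y, ∑ m : M, ((θ m)⁻¹ : ℂˣ) • ind T.subtype σ m y ∈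
      LinearMap.range (IndV.mk T.subtype σ 1) := by
    let p : Submodule ℂ (IndV T.subtype σ) := (LinearMap.range (IndV.mk T.subtype σ 1)).comap
      (∑ m : M, (((θ m)⁻¹ : ℂˣ) : ℂ) • ind T.subtype σ m)
    have hp : ∀ y, y ∈ p ↔ ∑ m : M, ((θ m)⁻¹ : ℂˣ) • ind T.subtype σ m y ∈
        LinearMap.range (IndV.mk T.subtype σ 1) := by
      intro y
      rw [Submodule.mem_comap, LinearMap.sum_apply]
      rfl
    refine fun y => (hp y).1 (indV_span (fun g w => (hp _).2 ?_) y)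
    by_cases hg : g ∈ T
    · rw [(sum_theta_ind hT hMT hW g w).1 hg]
      refine Submodule.smul_mem _ _ ⟨σ ⟨g, hg⟩⁻¹ w, ?_⟩
      rw [← indV_mk_mul, mul_one]
    · rw [(sum_theta_ind hT hMT hW g w).2 hg]
      exact zero_mem _
  have h2 := h1 x
  rw [Finset.sum_congr rfl fun m _ => by
    rw [hx, Units.smul_def, smul_smul, Units.inv_mul, one_smul], Finset.sum_const,
    ← Nat.cast_smul_eq_nsmul ℂ] at h2
  have hc : ((Finset.univ : Finset M).card : ℂ) ≠ 0 := by
    have : (Finset.univ : Finset M).card ≠ 0 := (Finset.card_pos.2 ⟨1, Finset.mem_univ _⟩).ne'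
    exact_mod_cast this
  exact (Submodule.smul_mem_iff _ hc).1 h2

/-- Mackey's criterion for a representation of the stabilizer of a character of a normal
subgroup. -/
lemma ind_irreducible [Finite G]
    (hT : ∀ g, g ∈ T ↔ ∀ m, θ (MulAut.conjNormal g m) = θ m)
    (hMT : M ≤ T) (hW : ∀ (m : M) w, σ (Subgroup.inclusion hMT m) w = (θ m : ℂ) • w)
    (hσ : σ.IsIrreducible) : (ind T.subtype σ).IsIrreducible := by
  classical
  have := Fintype.ofFinite M
  have := Fintype.ofFinite G
  have := nontrivial_of_irreducible hσ
  obtain ⟨π, hπ⟩ := exists_indV_retraction σ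
  obtain ⟨w₀, hw₀⟩ := exists_ne (0 : W)
  have hne : ∀ w, w ≠ 0 → IndV.mk T.subtype σ 1 w ≠ 0 := fun w hw h => hw (by
    rw [← hπ w, h, map_zero])
  have : Nontrivial (IndV T.subtype σ) := ⟨⟨_, 0, hne w₀ hw₀⟩⟩
  refine irreducible_of_forall_mem fun q hq x hx hx0 y => ?_
  let e : Module.End ℂ (IndV T.subtype σ) :=
    ∑ m : M, (((θ m)⁻¹ : ℂˣ) : ℂ) • ind T.subtype σ m
  have he : ∀ y, e y = ∑ m : M, ((θ m)⁻¹ : ℂˣ) • ind T.subtype σ m y := fun y => by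
    rw [LinearMap.sum_apply]
    rfl
  -- Up to the factor $|M|$, $geg^{-1}$ is the projection onto the translates `h` with $hg\in T$,
  -- and each `h` is hit $|T|$ times. So the conjugates of `e` cannot all kill a nonzero vector.
  have hsum : ∀ y, ∑ g : G, ind T.subtype σ g (e (ind T.subtype σ g⁻¹ y)) =
      ((Finset.univ.filter fun g => g ∈ T).card * Fintype.card M : ℂ) • y := by
    have h0 : ∑ g : G, ind T.subtype σ g * e * ind T.subtype σ g⁻¹ =
        ((Finset.univ.filter fun g => g ∈ T).card * Fintype.card M : ℂ) • 1 := by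
      refine IndV.hom_ext _ _ fun h => LinearMap.ext fun w => ?_
      change (∑ g : G, ind T.subtype σ g * e * ind T.subtype σ g⁻¹) (IndV.mk T.subtype σ h w) =
        ((Finset.univ.filter fun g => g ∈ T).card * Fintype.card M : ℂ) • IndV.mk T.subtype σ h w
      rw [LinearMap.sum_apply]
      have h1 : ∀ g : G, (ind T.subtype σ g * e * ind T.subtype σ g⁻¹) (IndV.mk T.subtype σ h w) =
          if h * g ∈ T then (Fintype.card M : ℂ) • IndV.mk T.subtype σ h w else 0 := by
        intro g
        rw [Module.End.mul_apply, Module.End.mul_apply, ind_mk, inv_inv, he]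
        split_ifs with hg
        · rw [(sum_theta_ind hT hMT hW _ w).1 hg, map_smul, ind_mk, mul_inv_cancel_right]
        · rw [(sum_theta_ind hT hMT hW _ w).2 hg, map_zero]
      rw [Finset.sum_congr rfl fun g _ => h1 g, Fintype.sum_equiv (Equiv.mulLeft h)
        (fun g => if h * g ∈ T then (Fintype.card M : ℂ) • IndV.mk T.subtype σ h w else 0)
        (fun g => if g ∈ T then (Fintype.card M : ℂ) • IndV.mk T.subtype σ h w else 0)
        (fun g => rfl), ← Finset.sum_filter, Finset.sum_const, ← Nat.cast_smul_eq_nsmul ℂ,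
        smul_smul]
    intro y
    have h2 := congrArg (fun f : Module.End ℂ (IndV T.subtype σ) => f y) h0
    simp only [LinearMap.sum_apply, Module.End.mul_apply] at h2
    exact h2
  have hex : ∃ g : G, e (ind T.subtype σ g⁻¹ x) ≠ 0 := by
    by_contra h
    push Not at h
    have h1 := hsum x
    rw [Finset.sum_eq_zero fun g _ => by rw [h g, map_zero]] at h1
    refine smul_ne_zero (mul_ne_zero ?_ ?_) hx0 h1.symm
    · have : (1 : G) ∈ Finset.univ.filter fun g => g ∈ T := by simp [T.one_mem]
      exact_mod_cast (Finset.card_pos.2 ⟨_, this⟩).ne'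
    · exact_mod_cast Fintype.card_ne_zero
  obtain ⟨g, hg⟩ := hex
  have hmem : e (ind T.subtype σ g⁻¹ x) ∈ q := by
    rw [he]
    exact sum_mem fun m _ => Submodule.smul_mem q (((θ m)⁻¹ : ℂˣ) : ℂ) (hq _ _ (hq _ _ hx))
  have heig : ∀ (m : M) y, ind T.subtype σ m (e y) = (θ m : ℂ) • e y := by
    intro m y
    rw [he, map_sum, Finset.smul_sum, ← Equiv.sum_comp (Equiv.mulLeft m)
      (fun m' => (θ m : ℂ) • ((θ m')⁻¹ : ℂˣ) • ind T.subtype σ m' y)]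
    refine Finset.sum_congr rfl fun m' _ => ?_
    rw [Units.smul_def, map_smul, ← Module.End.mul_apply, ← map_mul, Units.smul_def, smul_smul,
      ← Units.val_mul]
    congr 2
    simp
  obtain ⟨w, hw⟩ := mem_range_of_eigenvector hT hMT hW fun m => heig m (ind T.subtype σ g⁻¹ x)
  have hw0 : w ≠ 0 := by
    rintro rfl
    exact hg (by rw [← hw, map_zero])
  -- The submodule now meets the copy of `W` nontrivially; irreducibility of `σ` puts all of `W` in
  -- it, and its translates span.
  have hall : ∀ w', IndV.mk T.subtype σ 1 w' ∈ q :=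
    mem_of_irreducible hσ (q.comap (IndV.mk T.subtype σ 1)) (fun t v hv => by
      have h1 := hq t _ hv
      rw [ind_mk, one_mul, ← mul_one ((t : G)⁻¹), ← Subgroup.coe_inv, indV_mk_mul, inv_inv] at h1
      exact h1) (v := w) (by rw [Submodule.mem_comap, hw]; exact hmem) hw0
  refine indV_span (fun h w' => ?_) y
  have h1 := hq h⁻¹ _ (hall w')
  rwa [ind_mk, inv_inv, one_mul] at h1

/-- Induction from the stabilizer of a character is injective on irreducible representations over
that character. -/
lemma equiv_of_ind_equiv [Finite G] {W' : Type*} [AddCommGroup W'] [Module ℂ W']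
    {σ' : Representation ℂ T W'}
    (hT : ∀ g, g ∈ T ↔ ∀ m, θ (MulAut.conjNormal g m) = θ m) (hMT : M ≤ T)
    (hW : ∀ (m : M) w, σ (Subgroup.inclusion hMT m) w = (θ m : ℂ) • w)
    (hW' : ∀ (m : M) w, σ' (Subgroup.inclusion hMT m) w = (θ m : ℂ) • w)
    (hσ : σ.IsIrreducible) (hσ' : σ'.IsIrreducible)
    (Φ : (ind T.subtype σ).Equiv (ind T.subtype σ')) : Nonempty (σ.Equiv σ') := by
  have := nontrivial_of_irreducible hσ
  obtain ⟨π, hπ⟩ := exists_indV_retraction σ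
  obtain ⟨π', hπ'⟩ := exists_indV_retraction σ'
  obtain ⟨w₀, hw₀⟩ := exists_ne (0 : W)
  -- `Φ` respects the `θ`-eigenspaces, which are the copies of `W` and `W'`; so the retraction loses
  -- nothing here.
  let f : W →ₗ[ℂ] W' := π' ∘ₗ Φ.toLinearEquiv.toLinearMap ∘ₗ IndV.mk T.subtype σ 1
  have hΦ := equiv_apply_rho Φ
  have hf : ∀ w, IndV.mk T.subtype σ' 1 (f w) = Φ (IndV.mk T.subtype σ 1 w) := by
    intro w
    obtain ⟨w', hw'⟩ := mem_range_of_eigenvector hT hMT hW' (x := Φ (IndV.mk T.subtype σ 1 w))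
      fun m => by
        rw [← hΦ, ind_apply_normal hMT hW, map_smul, map_one]
        rfl
    change IndV.mk T.subtype σ' 1 (π' (Φ (IndV.mk T.subtype σ 1 w))) = _
    rw [← hw', hπ']
  have hι : ∀ (t : T) w, IndV.mk T.subtype σ 1 (σ t w) =
      ind T.subtype σ t (IndV.mk T.subtype σ 1 w) := by
    intro t w
    rw [ind_mk, one_mul, ← mul_one ((t : G)⁻¹), ← Subgroup.coe_inv, indV_mk_mul, inv_inv]
  have hι' : ∀ (t : T) w, IndV.mk T.subtype σ' 1 (σ' t w) =
      ind T.subtype σ' t (IndV.mk T.subtype σ' 1 w) := by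
    intro t w
    rw [ind_mk, one_mul, ← mul_one ((t : G)⁻¹), ← Subgroup.coe_inv, indV_mk_mul, inv_inv]
  obtain ⟨e, -⟩ := equiv_of_irreducible hσ hσ' f (fun t w => by
    rw [← hπ' (f (σ t w)), hf, hι, hΦ, ← hf, ← hι', hπ']) (v := w₀) (by
    intro h
    have h1 := hf w₀
    rw [h, map_zero] at h1
    have h2 : IndV.mk T.subtype σ 1 w₀ = 0 := by
      apply Φ.toLinearEquiv.injective
      rw [map_zero]
      exact h1.symm
    exact hw₀ (by rw [← hπ w₀, h2, map_zero]))
  exact ⟨e⟩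

/-- A form of Frobenius reciprocity. -/
lemma exists_ind_map {V : Type*} [AddCommGroup V] [Module ℂ V] {ρ : Representation ℂ G V}
    (f : W →ₗ[ℂ] V) (hf : ∀ (t : T) w, f (σ t w) = ρ t (f w)) :
    ∃ F : IndV T.subtype σ →ₗ[ℂ] V, (∀ g x, F (ind T.subtype σ g x) = ρ g (F x)) ∧
      ∀ w, F (IndV.mk T.subtype σ 1 w) = f w := by
  -- The class of $(h,w)$ must go to $\rho(h)^{-1}f(w)$, since `g` acts on labels by $h\mapsto
  -- hg^{-1}$.
  let F : IndV T.subtype σ →ₗ[ℂ] V := Coinvariants.lift _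
    (TensorProduct.lift <| (Finsupp.lift _ _ _ fun h : G => ρ h⁻¹ ∘ₗ f) ∘ₗ
      (MonoidAlgebra.coeffLinearEquiv ℂ).toLinearMap) fun t => by
        ext h w
        simp [hf]
  have hF : ∀ h w, F (IndV.mk T.subtype σ h w) = ρ h⁻¹ (f w) := fun h w => by simp [F]
  refine ⟨F, fun g x => ?_, fun w => by rw [hF, inv_one, map_one]; rfl⟩
  let p : Submodule ℂ (IndV T.subtype σ) :=
    LinearMap.ker (F ∘ₗ ind T.subtype σ g - ρ g ∘ₗ F)
  have hp : x ∈ p := indV_span (fun h w => by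
    change F (ind T.subtype σ g (IndV.mk T.subtype σ h w)) - ρ g (F (IndV.mk T.subtype σ h w)) = 0
    rw [ind_mk, hF, hF, mul_inv_rev, inv_inv, map_mul]
    exact sub_self _) x
  exact sub_eq_zero.1 hp

end Induced

/-! ### Twists by characters inflated from an abelian quotient -/

section Twist

variable {Γ : Type u} [Group Γ]

/-- The twist of a representation by a character, on the same space. -/
noncomputable def twist (χ : Γ →* ℂˣ) {V : Type*} [AddCommGroup V] [Module ℂ V]
    (ρ : Representation ℂ Γ V) : Representation ℂ Γ V where
  toFun g := (χ g : ℂ) • ρ g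
  map_one' := by simp
  map_mul' a b := by rw [map_mul, map_mul, Units.val_mul, smul_mul_smul_comm]

lemma twist_apply (χ : Γ →* ℂˣ) {V : Type*} [AddCommGroup V] [Module ℂ V]
    (ρ : Representation ℂ Γ V) (g : Γ) (v : V) : twist χ ρ g v = (χ g : ℂ) • ρ g v := rfl

lemma exists_charTensor_equiv (χ : Γ →* ℂˣ) (A : Rep.{u} ℂ Γ) :
    ∃ e : (charTensor χ A).V ≃ₗ[ℂ] A.V, ∀ g v, e ((charTensor χ A).ρ g v) =
      twist χ A.ρ g (e v) := by
  let e : (charTensor χ A).V ≃ₗ[ℂ] A.V := TensorProduct.lid ℂ A.V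
  refine ⟨e, fun g v => ?_⟩
  have h : e.toLinearMap ∘ₗ (charTensor χ A).ρ g = twist χ A.ρ g ∘ₗ e.toLinearMap := by
    refine TensorProduct.ext' fun c v => ?_
    change TensorProduct.lid ℂ A.V (TensorProduct.map (charRep χ g) (A.ρ g) (c ⊗ₜ[ℂ] v)) =
      (χ g : ℂ) • A.ρ g (TensorProduct.lid ℂ A.V (c ⊗ₜ[ℂ] v))
    rw [TensorProduct.map_tmul, TensorProduct.lid_tmul, TensorProduct.lid_tmul, map_smul, smul_smul]
    rfl
  exact congrArg (fun f : (charTensor χ A).V →ₗ[ℂ] A.V => f v) h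

lemma irreducible_of_comp {Γ' : Type*} [Group Γ'] (j : Γ' →* Γ) {V : Type*} [AddCommGroup V]
    [Module ℂ V] {ρ : Representation ℂ Γ V}
    (h : Representation.IsIrreducible (ρ.comp j : Representation ℂ Γ' V)) : ρ.IsIrreducible := by
  have := nontrivial_of_irreducible h
  exact irreducible_of_forall_mem fun p hp v hv hv0 w =>
    mem_of_irreducible h p (fun g v hv => hp (j g) v hv) hv hv0 w

variable {H N : Subgroup Γ} [N.Normal]

lemma inflateChar_mul (χ : H ⧸ N.subgroupOf H →* ℂˣ) (c : H) (n : N) :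
    inflateChar H N χ (Subgroup.inclusion le_sup_left c * Subgroup.inclusion le_sup_right n) =
      χ (QuotientGroup.mk c) := by
  have h1 : QuotientGroup.mk' (N.subgroupOf (H ⊔ N))
      (Subgroup.inclusion le_sup_left c * Subgroup.inclusion le_sup_right n) =
      QuotientGroup.quotientInfEquivProdNormalQuotient H N (QuotientGroup.mk c) := by
    have h2 : QuotientGroup.quotientInfEquivProdNormalQuotient H N (QuotientGroup.mk c) =
      QuotientGroup.mk' (N.subgroupOf (H ⊔ N)) (Subgroup.inclusion le_sup_left c) := rfl
    rw [h2, map_mul, mul_eq_left]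
    exact (QuotientGroup.eq_one_iff _).2 n.2
  change χ ((QuotientGroup.quotientInfEquivProdNormalQuotient H N).symm _) = _
  rw [h1, MulEquiv.symm_apply_apply]

lemma inflateChar_normal (χ : H ⧸ N.subgroupOf H →* ℂˣ) (n : N) :
    inflateChar H N χ (Subgroup.inclusion le_sup_right n) = 1 := by
  have := inflateChar_mul χ 1 n
  rwa [map_one, one_mul, QuotientGroup.mk_one, map_one] at this

lemma inflateChar_injective : Function.Injective (inflateChar H N) := by
  intro χ χ' h
  refine MonoidHom.ext fun x => ?_
  obtain ⟨c, rfl⟩ := QuotientGroup.mk_surjective x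
  rw [← inflateChar_mul χ c 1, ← inflateChar_mul χ' c 1, h]

lemma exists_inflateChar_eq (χ' : (H ⊔ N : Subgroup Γ) →* ℂˣ)
    (h : ∀ n : N, χ' (Subgroup.inclusion le_sup_right n) = 1) :
    ∃ χ : H ⧸ N.subgroupOf H →* ℂˣ, inflateChar H N χ = χ' := by
  refine ⟨QuotientGroup.lift (N.subgroupOf H) (χ'.comp (Subgroup.inclusion le_sup_left))
    fun c hc => h ⟨c, hc⟩, MonoidHom.ext ?_⟩
  rintro ⟨t, ht⟩
  obtain ⟨c, hc, n, hn, rfl⟩ := Subgroup.mem_sup_of_normal_right.1 ht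
  have h1 := inflateChar_mul (QuotientGroup.lift (N.subgroupOf H)
    (χ'.comp (Subgroup.inclusion le_sup_left)) fun c hc => h ⟨c, hc⟩) ⟨c, hc⟩ ⟨n, hn⟩
  refine h1.trans ?_
  have h2 := map_mul χ' (Subgroup.inclusion le_sup_left ⟨c, hc⟩)
    (Subgroup.inclusion (le_sup_right : N ≤ H ⊔ N) ⟨n, hn⟩)
  rw [h, mul_one] at h2
  exact h2.symm

/-- The quotient $HN/N$ is the image of the commutative group `H`. -/
lemma commutator_mem_of_mem_sup (hH : ∀ a ∈ H, ∀ b ∈ H, a * b = b * a) {s t : Γ} (hs : s ∈ H ⊔ N)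
    (ht : t ∈ H ⊔ N) : s⁻¹ * t⁻¹ * s * t ∈ N := by
  obtain ⟨c, hc, n, hn, rfl⟩ := Subgroup.mem_sup_of_normal_right.1 hs
  obtain ⟨c', hc', n', hn', rfl⟩ := Subgroup.mem_sup_of_normal_right.1 ht
  have h1 : ∀ x ∈ N, (QuotientGroup.mk x : Γ ⧸ N) = 1 := fun x hx => (QuotientGroup.eq_one_iff x).2 hx
  have h2 : (QuotientGroup.mk c * QuotientGroup.mk c' : Γ ⧸ N) =
      QuotientGroup.mk c' * QuotientGroup.mk c := by
    rw [← QuotientGroup.mk_mul, hH c hc c' hc', QuotientGroup.mk_mul]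
  rw [← QuotientGroup.eq_one_iff]
  simp only [QuotientGroup.mk_mul, QuotientGroup.mk_inv, h1 n hn, h1 n' hn', mul_one]
  rw [mul_assoc, h2]
  group

end Twist

/-! ### Heisenberg data: stability and extension of the representations over `ψ` -/

/-- A group `G` with subgroups `M ≤ H ≤ N` and `C`, and a character `θ` of `M` with stabilizer
`CN`, for which `H / M` is the radical of the commutator pairing on `N / M` defined by `θ`. -/
structure IsHeisenbergDatum {G : Type u} [Group G] (C N H M : Subgroup G) [N.Normal] [M.Normal]
    (θ : M →* ℂˣ) : Prop where
  le : M ≤ H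
  le' : H ≤ N
  comm : ∀ a ∈ C, ∀ b ∈ C, a * b = b * a
  stabilizer : ∀ g, g ∈ C ⊔ N ↔ ∀ m, θ (MulAut.conjNormal g m) = θ m
  commutator_mem : ∀ a ∈ N, ∀ b ∈ N, a * b * a⁻¹ * b⁻¹ ∈ M
  radical : ∀ a (ha : a ∈ N), a ∈ H ↔
    ∀ b (hb : b ∈ N), θ ⟨b * a * b⁻¹ * a⁻¹, commutator_mem b hb a ha⟩ = 1
  decomp : ∀ ε ∈ C, ∀ h ∈ H, ∃ c ∈ H, ∃ m ∈ M, h = c * m ∧ ε * c = c * ε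

namespace IsHeisenbergDatum

variable {G : Type u} [Group G] {C N H M : Subgroup G} [N.Normal] [M.Normal]
    {θ : M →* ℂˣ} (D : IsHeisenbergDatum C N H M θ) {ψ : H →* ℂˣ}

include D

lemma le_sup : M ≤ C ⊔ N := (D.le.trans D.le').trans le_sup_right

/-- Conjugation changes $x\in H$ by the commutator $n^{-1}xnx^{-1}\in M$, on which $\psi=\theta$ is
trivial because `x` is in the radical. -/
lemma conj_mem (hψ : ψ.comp (Subgroup.inclusion D.le) = θ) (n : N) (x : H) :
    ∃ x' : H, n⁻¹ * Subgroup.inclusion D.le' x * n = Subgroup.inclusion D.le' x' ∧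
      ψ x' = ψ x := by
  let b := Subgroup.inclusion D.le
    ⟨_, D.commutator_mem _ (inv_mem n.2) x (D.le' x.2)⟩
  have hb : ψ b = 1 :=
    (congrArg (fun f : M →* ℂˣ => f ⟨_, D.commutator_mem _ (inv_mem n.2) x (D.le' x.2)⟩) hψ).trans
      ((D.radical x (D.le' x.2)).1 x.2 _ (inv_mem n.2))
  refine ⟨b * x, Subtype.ext ?_, by rw [map_mul, hb, one_mul]⟩
  change (n : G)⁻¹ * x * n = ((n : G)⁻¹ * x * (n : G)⁻¹⁻¹ * (x : G)⁻¹) * x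
  group

lemma exists_commutator_ne_one (hψ : ψ.comp (Subgroup.inclusion D.le) = θ) (n : N)
    (hn : n ∉ (Subgroup.inclusion D.le').range) :
    ∃ (m : N) (x : H), m * n * m⁻¹ = Subgroup.inclusion D.le' x * n ∧ ψ x ≠ 1 := by
  have hn' : (n : G) ∉ H := fun h => hn ⟨⟨n, h⟩, rfl⟩
  rw [D.radical n n.2] at hn'
  push Not at hn'
  obtain ⟨b, hb, h⟩ := hn'
  refine ⟨⟨b, hb⟩, Subgroup.inclusion D.le ⟨_, D.commutator_mem b hb n n.2⟩, Subtype.ext ?_, ?_⟩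
  · change b * n * b⁻¹ = b * n * b⁻¹ * (n : G)⁻¹ * n
    group
  · exact fun h1 => h ((congrArg (fun f : M →* ℂˣ => f _) hψ).symm.trans h1)

/-- Write $x=cm$ as in `decomp`: `ε` fixes the factor `c`, and it moves `m` inside `M` without
changing `θ`, since it lies in the stabilizer. -/
lemma conj_mem_of_mem (hψ : ψ.comp (Subgroup.inclusion D.le) = θ) (ε : C) (x : H) :
    ∃ x' : H, (ε * x * (ε : G)⁻¹ : G) = x' ∧ ψ x' = ψ x := by
  obtain ⟨c, hc, m, hm, hx, hcomm⟩ := D.decomp ε ε.2 x x.2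
  have hst := (D.stabilizer ε).1 ((le_sup_left : C ≤ C ⊔ N) ε.2) ⟨m, hm⟩
  have hm' : ∀ m : M, ψ (Subgroup.inclusion D.le m) = θ m := fun m =>
    congrArg (fun f : M →* ℂˣ => f m) hψ
  refine ⟨⟨c, hc⟩ * Subgroup.inclusion D.le (MulAut.conjNormal (ε : G) ⟨m, hm⟩), ?_, ?_⟩
  · change (ε * x * (ε : G)⁻¹ : G) = c * (ε * m * (ε : G)⁻¹)
    rw [hx, ← mul_assoc, hcomm]
    group
  · rw [map_mul, hm', hst, ← hm', ← map_mul]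
    congr 1
    exact Subtype.ext hx.symm

lemma equiv_of_liesOver [Finite G] (hψ : ψ.comp (Subgroup.inclusion D.le) = θ)
    {V W : Type*} [AddCommGroup V] [Module ℂ V] [AddCommGroup W] [Module ℂ W]
    {ρ : Representation ℂ N V} {σ : Representation ℂ N W}
    (hρ : ρ.IsIrreducible) (hσ : σ.IsIrreducible)
    {v : V} (hv : v ≠ 0) (h : ∀ x, ρ (Subgroup.inclusion D.le' x) v = (ψ x : ℂ) • v)
    {w : W} (hw : w ≠ 0) (h' : ∀ x, σ (Subgroup.inclusion D.le' x) w = (ψ x : ℂ) • w) :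
    Nonempty (ρ.Equiv σ) :=
  equiv_of_irreducible_over (D.conj_mem hψ) (D.exists_commutator_ne_one hψ) hρ hσ hv h hw h'

/-- The conjugate of `A` by `ε` is irreducible and again lies over `ψ`, so uniqueness applies to the
pair. -/
lemma exists_intertwiner [Finite G] (hψ : ψ.comp (Subgroup.inclusion D.le) = θ)
    {A : Rep.{u} ℂ N} (hA : A.ρ.IsIrreducible) (hAψ : LiesOver (Subgroup.inclusion D.le') ψ A)
    (ε : C) : ∃ U : A.V ≃ₗ[ℂ] A.V, ∀ k : N, ∀ v,
      A.ρ (MulAut.conjNormal (ε : G) k) (U v) = U (A.ρ k v) := by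
  obtain ⟨v, hv, h⟩ := (liesOver_iff _ _ _).1 hAψ
  let A' : Representation ℂ N A.V := A.ρ.comp (MulAut.conjNormal (ε : G) : MulAut N).toMonoidHom
  have hA' : A'.IsIrreducible := by
    have := nontrivial_of_irreducible hA
    refine irreducible_of_forall_mem fun p hp v hv hv0 w =>
      mem_of_irreducible hA p (fun g v hv => ?_) hv hv0 w
    have h1 := hp (MulAut.conjNormal (ε : G)⁻¹ g) v hv
    change A.ρ (MulAut.conjNormal (ε : G) (MulAut.conjNormal (ε : G)⁻¹ g)) v ∈ p at h1
    rwa [← MulAut.mul_apply, ← map_mul, mul_inv_cancel, map_one, MulAut.one_apply] at h1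
  obtain ⟨e⟩ := D.equiv_of_liesOver hψ hA hA' hv h hv fun x => by
    obtain ⟨x', hx', hψx⟩ := D.conj_mem_of_mem hψ ε x
    rw [← hψx, ← h]
    change A.ρ _ v = _
    congr 2
    exact Subtype.ext hx'
  exact ⟨e.toLinearEquiv, fun k v => (equiv_apply_rho e k v).symm⟩

lemma exists_extension [Finite G] (hψ : ψ.comp (Subgroup.inclusion D.le) = θ)
    {A : Rep.{u} ℂ N} (hA : A.ρ.IsIrreducible) (hAψ : LiesOver (Subgroup.inclusion D.le') ψ A)
    (hyp : ∀ c : groupCohomology.H2 (unitsCoeff C), IsSchurMultiplier C N A c → c = 0) :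
    ∃ B : Rep.{u} ℂ (C ⊔ N : Subgroup G),
      Nonempty (Rep.res (Subgroup.inclusion (le_sup_right : N ≤ C ⊔ N)) B ≅ A) := by
  obtain ⟨B, hB⟩ := exists_extension_of_schurMultiplier D.comm A hA
    (D.exists_intertwiner hψ hA hAψ) hyp
  refine ⟨Rep.of B, ⟨Rep.mkIso (Representation.Equiv.mk (LinearEquiv.refl ℂ A.V) fun k => ?_)⟩⟩
  exact hB k

end IsHeisenbergDatum


/-! ### Clifford correspondence for a Heisenberg datum -/

namespace IsHeisenbergDatum

variable {G : Type u} [Group G] {C N H M : Subgroup G} [N.Normal] [M.Normal]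
    {θ : M →* ℂˣ} (D : IsHeisenbergDatum C N H M θ) {ψ ψ' : H →* ℂˣ}
    {A A' : Rep.{u} ℂ N} {B B' : Rep.{u} ℂ (C ⊔ N : Subgroup G)}

include D

lemma apply_eq_smul_of_extension
    (hψ : ψ.comp (Subgroup.inclusion D.le) = θ)
    (hA : A.ρ.IsIrreducible) (hAψ : LiesOver (Subgroup.inclusion D.le') ψ A)
    (i : Rep.res (Subgroup.inclusion (le_sup_right : N ≤ C ⊔ N)) B ≅ A) (x : H) (v : B.V) :
    B.ρ (Subgroup.inclusion le_sup_right (Subgroup.inclusion D.le' x)) v = (ψ x : ℂ) • v := by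
  obtain ⟨w, hw, h⟩ := (liesOver_iff _ _ _).1 hAψ
  let e := Representation.equivOfIso i
  apply e.toLinearEquiv.injective
  rw [map_smul]
  refine (equiv_apply_rho e (Subgroup.inclusion D.le' x) v).trans ?_
  exact central_of_irreducible (D.conj_mem hψ) hA hw h x _

omit D [N.Normal] in
lemma irreducible_of_extension (hA : A.ρ.IsIrreducible)
    (i : Rep.res (Subgroup.inclusion (le_sup_right : N ≤ C ⊔ N)) B ≅ A) :
    Representation.IsIrreducible
      (B.ρ.comp (Subgroup.inclusion (le_sup_right : N ≤ C ⊔ N)) : Representation ℂ N B.V) :=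
  irreducible_of_equiv (Representation.equivOfIso i).symm hA

omit D in
lemma charTensor_irreducible (χ : C ⧸ N.subgroupOf C →* ℂˣ) (hA : A.ρ.IsIrreducible)
    (i : Rep.res (Subgroup.inclusion (le_sup_right : N ≤ C ⊔ N)) B ≅ A) :
    (charTensor (inflateChar C N χ) B).ρ.IsIrreducible := by
  obtain ⟨e, he⟩ := exists_charTensor_equiv (inflateChar C N χ) B
  refine irreducible_of_linearEquiv (ρ := twist (inflateChar C N χ) B.ρ) e.symm (fun g v => ?_) ?_
  · rw [LinearEquiv.symm_apply_eq, he, LinearEquiv.apply_symm_apply]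
  · refine irreducible_of_comp (Subgroup.inclusion (le_sup_right : N ≤ C ⊔ N)) ?_
    have h := irreducible_of_extension hA i
    have h1 : ((twist (inflateChar C N χ) B.ρ).comp
        (Subgroup.inclusion (le_sup_right : N ≤ C ⊔ N)) : Representation ℂ N B.V) =
        B.ρ.comp (Subgroup.inclusion (le_sup_right : N ≤ C ⊔ N)) := by
      refine MonoidHom.ext fun k => LinearMap.ext fun v => ?_
      change (inflateChar C N χ (Subgroup.inclusion le_sup_right k) : ℂ) •
        B.ρ (Subgroup.inclusion le_sup_right k) v = _
      rw [inflateChar_normal, Units.val_one, one_smul]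
      rfl
    rw [h1]
    exact h

lemma charTensor_apply (χ : C ⧸ N.subgroupOf C →* ℂˣ)
    (hψ : ψ.comp (Subgroup.inclusion D.le) = θ)
    (hA : A.ρ.IsIrreducible) (hAψ : LiesOver (Subgroup.inclusion D.le') ψ A)
    (i : Rep.res (Subgroup.inclusion (le_sup_right : N ≤ C ⊔ N)) B ≅ A) (m : M)
    (v : (charTensor (inflateChar C N χ) B).V) :
    (charTensor (inflateChar C N χ) B).ρ (Subgroup.inclusion D.le_sup m) v = (θ m : ℂ) • v := by
  obtain ⟨e, he⟩ := exists_charTensor_equiv (inflateChar C N χ) B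
  apply e.injective
  have h1 : Subgroup.inclusion D.le_sup m =
    Subgroup.inclusion le_sup_right (Subgroup.inclusion D.le' (Subgroup.inclusion D.le m)) := rfl
  rw [he, h1, twist_apply, inflateChar_normal, Units.val_one, one_smul,
    D.apply_eq_smul_of_extension hψ hA hAψ i, map_smul]
  exact congrArg (fun f : M →* ℂˣ => (f m : ℂ) • e v) hψ

lemma ind_charTensor_irreducible [Finite G] (χ : C ⧸ N.subgroupOf C →* ℂˣ)
    (hψ : ψ.comp (Subgroup.inclusion D.le) = θ)
    (hA : A.ρ.IsIrreducible) (hAψ : LiesOver (Subgroup.inclusion D.le') ψ A)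
    (i : Rep.res (Subgroup.inclusion (le_sup_right : N ≤ C ⊔ N)) B ≅ A) :
    (Rep.ind (C ⊔ N).subtype (charTensor (inflateChar C N χ) B)).ρ.IsIrreducible :=
  ind_irreducible D.stabilizer D.le_sup (D.charTensor_apply χ hψ hA hAψ i)
    (charTensor_irreducible χ hA i)

lemma ind_charTensor_mem [Finite G] (χ : C ⧸ N.subgroupOf C →* ℂˣ)
    (hψ : ψ.comp (Subgroup.inclusion D.le) = θ)
    (hA : A.ρ.IsIrreducible) (hAψ : LiesOver (Subgroup.inclusion D.le') ψ A)
    (i : Rep.res (Subgroup.inclusion (le_sup_right : N ≤ C ⊔ N)) B ≅ A) :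
    repClass (Rep.ind (C ⊔ N).subtype (charTensor (inflateChar C N χ) B)) ∈
      IrrOver M.subtype θ := by
  refine ⟨_, D.ind_charTensor_irreducible χ hψ hA hAψ i, (liesOver_iff _ _ _).2 ?_, rfl⟩
  have hirr := charTensor_irreducible χ hA i
  have := nontrivial_of_irreducible hirr
  obtain ⟨w, hw⟩ := exists_ne (0 : (charTensor (inflateChar C N χ) B).V)
  obtain ⟨p, hp⟩ := exists_indV_retraction (charTensor (inflateChar C N χ) B).ρ
  refine ⟨Representation.IndV.mk (C ⊔ N).subtype _ 1 w, fun h => hw ?_, fun m => ?_⟩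
  · rw [← hp w, h, map_zero]
  · have h1 := ind_apply_normal D.le_sup (D.charTensor_apply χ hψ hA hAψ i) m 1 w
    rw [map_one, MulAut.one_apply] at h1
    exact h1

/-- Passing to `θ`-eigenspaces removes the induction. The resulting map on the original spaces is
the input for recovering both parameters. -/
lemma exists_twist_equiv_of_ind [Finite G] {χ χ' : C ⧸ N.subgroupOf C →* ℂˣ}
    (hψ : ψ.comp (Subgroup.inclusion D.le) = θ) (hψ' : ψ'.comp (Subgroup.inclusion D.le) = θ)
    (hA : A.ρ.IsIrreducible) (hAψ : LiesOver (Subgroup.inclusion D.le') ψ A)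
    (hA' : A'.ρ.IsIrreducible) (hAψ' : LiesOver (Subgroup.inclusion D.le') ψ' A')
    (i : Rep.res (Subgroup.inclusion (le_sup_right : N ≤ C ⊔ N)) B ≅ A)
    (i' : Rep.res (Subgroup.inclusion (le_sup_right : N ≤ C ⊔ N)) B' ≅ A')
    (h : repClass (Rep.ind (C ⊔ N).subtype (charTensor (inflateChar C N χ) B)) =
      repClass (Rep.ind (C ⊔ N).subtype (charTensor (inflateChar C N χ') B'))) :
    ∃ f : B.V ≃ₗ[ℂ] B'.V, ∀ t v,
      f ((inflateChar C N χ t : ℂ) • B.ρ t v) = (inflateChar C N χ' t : ℂ) • B'.ρ t (f v) := by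
  obtain ⟨Φ⟩ := repClass_eq_iff.1 h
  obtain ⟨E⟩ := equiv_of_ind_equiv D.stabilizer D.le_sup (D.charTensor_apply χ hψ hA hAψ i)
    (D.charTensor_apply χ' hψ' hA' hAψ' i') (charTensor_irreducible χ hA i)
    (charTensor_irreducible χ' hA' i') Φ
  obtain ⟨e, he⟩ := exists_charTensor_equiv (inflateChar C N χ) B
  obtain ⟨e', he'⟩ := exists_charTensor_equiv (inflateChar C N χ') B'
  refine ⟨e.symm.trans (E.toLinearEquiv.trans e'), fun t v => ?_⟩
  change e' (E (e.symm (twist (inflateChar C N χ) B.ρ t v))) =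
    twist (inflateChar C N χ') B'.ρ t (e' (E (e.symm v)))
  have h1 : e.symm (twist (inflateChar C N χ) B.ρ t v) =
      (charTensor (inflateChar C N χ) B).ρ t (e.symm v) := by
    rw [LinearEquiv.symm_apply_eq, he, LinearEquiv.apply_symm_apply]
  rw [h1, equiv_apply_rho, he']

/-- Inflated characters are trivial on `N`, so `H` acts on the two twists by the scalars `ψ` and
`ψ'`. -/
lemma eq_of_ind_equiv [Finite G] {χ χ' : C ⧸ N.subgroupOf C →* ℂˣ}
    (hψ : ψ.comp (Subgroup.inclusion D.le) = θ) (hψ' : ψ'.comp (Subgroup.inclusion D.le) = θ)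
    (hA : A.ρ.IsIrreducible) (hAψ : LiesOver (Subgroup.inclusion D.le') ψ A)
    (hA' : A'.ρ.IsIrreducible) (hAψ' : LiesOver (Subgroup.inclusion D.le') ψ' A')
    (i : Rep.res (Subgroup.inclusion (le_sup_right : N ≤ C ⊔ N)) B ≅ A)
    (i' : Rep.res (Subgroup.inclusion (le_sup_right : N ≤ C ⊔ N)) B' ≅ A')
    (h : repClass (Rep.ind (C ⊔ N).subtype (charTensor (inflateChar C N χ) B)) =
      repClass (Rep.ind (C ⊔ N).subtype (charTensor (inflateChar C N χ') B'))) :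
    ψ = ψ' := by
  obtain ⟨f, hf⟩ := D.exists_twist_equiv_of_ind hψ hψ' hA hAψ hA' hAψ' i i' h
  have := nontrivial_of_irreducible (irreducible_of_extension hA i)
  obtain ⟨v, hv⟩ := exists_ne (0 : B.V)
  refine MonoidHom.ext fun x => Units.ext ?_
  have h1 := hf (Subgroup.inclusion le_sup_right (Subgroup.inclusion D.le' x)) v
  rw [inflateChar_normal, inflateChar_normal, Units.val_one, one_smul, one_smul,
    D.apply_eq_smul_of_extension hψ hA hAψ i, D.apply_eq_smul_of_extension hψ' hA' hAψ' i',
    map_smul] at h1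
  exact smul_left_injective ℂ (by simpa using hv) h1

/-- On `N` the twists disappear, so the isomorphism commutes with the irreducible restriction of `B`
and is a scalar; comparing the two actions then identifies the characters. -/
lemma eq_of_ind_equiv_self [Finite G] {χ χ' : C ⧸ N.subgroupOf C →* ℂˣ}
    (hψ : ψ.comp (Subgroup.inclusion D.le) = θ)
    (hA : A.ρ.IsIrreducible) (hAψ : LiesOver (Subgroup.inclusion D.le') ψ A)
    (i : Rep.res (Subgroup.inclusion (le_sup_right : N ≤ C ⊔ N)) B ≅ A)
    (h : repClass (Rep.ind (C ⊔ N).subtype (charTensor (inflateChar C N χ) B)) =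
      repClass (Rep.ind (C ⊔ N).subtype (charTensor (inflateChar C N χ') B))) :
    χ = χ' := by
  obtain ⟨f, hf⟩ := D.exists_twist_equiv_of_ind hψ hψ hA hAψ hA hAψ i i h
  have hB := irreducible_of_extension hA i
  have := nontrivial_of_irreducible hB
  obtain ⟨v, hv⟩ := exists_ne (0 : B.V)
  obtain ⟨c, hc⟩ := exists_eq_smul_of_commute hB f.toLinearMap fun k v => by
    have h1 := hf (Subgroup.inclusion le_sup_right k) v
    rw [inflateChar_normal, inflateChar_normal, Units.val_one, one_smul, one_smul] at h1
    exact h1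
  have hc' : ∀ v, f v = c • v := hc
  have hc0 : c ≠ 0 := by
    rintro rfl
    have := hc' v
    rw [zero_smul] at this
    exact hv (by simpa using this)
  refine inflateChar_injective (MonoidHom.ext fun t => Units.ext ?_)
  have h1 := hf t v
  rw [hc', hc', map_smul, smul_comm c, ← smul_assoc, ← smul_assoc (inflateChar C N χ' t : ℂ)] at h1
  have hne : B.ρ t v ≠ 0 := by
    intro h0
    have h2 : B.ρ t⁻¹ (B.ρ t v) = v := by
      rw [← Module.End.mul_apply, ← map_mul, inv_mul_cancel, map_one]
      rfl
    exact hv (by rw [← h2, h0, map_zero])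
  have h2 := smul_left_injective ℂ hne h1
  exact mul_right_cancel₀ hc0 h2

/-- An irreducible representation over `θ` contains an extension of some character of `H`. -/
lemma exists_eigenvector [Finite G] {V : Type*} [AddCommGroup V] [Module ℂ V]
    {ρ : Representation ℂ G V} {v : V} (hv : v ≠ 0) (h : ∀ m : M, ρ m v = (θ m : ℂ) • v) :
    ∃ ψ : H →* ℂˣ, ψ.comp (Subgroup.inclusion D.le) = θ ∧ ∃ w, w ≠ 0 ∧
      ∀ x : H, ρ x w = (ψ x : ℂ) • w := by
  let p : Submodule ℂ V :=
    { carrier := {w | ∀ m : M, ρ m w = (θ m : ℂ) • w}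
      add_mem' := fun ha hb x => by rw [map_add, ha x, hb x, smul_add]
      zero_mem' := fun x => by simp
      smul_mem' := fun c w hw x => by rw [map_smul, hw x, smul_comm] }
  have hp : ∀ x : H, ∀ w ∈ p, ρ x w ∈ p := by
    intro x w hw m
    have hx : (x : G)⁻¹ ∈ C ⊔ N :=
      inv_mem ((le_sup_right : N ≤ C ⊔ N) (D.le' x.2))
    have h1 := hw (MulAut.conjNormal (x : G)⁻¹ m)
    rw [(D.stabilizer _).1 hx] at h1
    have h2 : (m : G) * x = x * (MulAut.conjNormal (x : G)⁻¹ m : M) := by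
      rw [MulAut.conjNormal_apply]
      group
    rw [← Module.End.mul_apply, ← map_mul, h2, map_mul, Module.End.mul_apply, h1, map_smul]
  -- On the `θ`-eigenspace commutators of `H` act through `θ`, which is $1$ on them by the radical
  -- condition; hence `H` acts by commuting operators.
  obtain ⟨ψ, w, hwp, hw, hψ⟩ := exists_common_eigenvector
    (ρ := (ρ.comp H.subtype : Representation ℂ H V)) p hp h hv fun x y w hw => by
      have h1 := hp x _ (hp y w hw)
      have h2 := hp y _ (hp x w hw) ⟨_, D.commutator_mem x (D.le' x.2) y (D.le' y.2)⟩
      have h3 : θ ⟨_, D.commutator_mem x (D.le' x.2) y (D.le' y.2)⟩ = 1 :=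
        (D.radical y (D.le' y.2)).1 y.2 x (D.le' x.2)
      rw [h3, Units.val_one, one_smul] at h2
      change ρ x (ρ y w) = ρ y (ρ x w)
      rw [← h2, ← Module.End.mul_apply, ← Module.End.mul_apply, ← Module.End.mul_apply, ← map_mul,
        ← map_mul, ← map_mul]
      congr 2
      group
  refine ⟨ψ, MonoidHom.ext fun m => Units.ext ?_, w, hw, hψ⟩
  exact smul_left_injective ℂ hw ((hψ (Subgroup.inclusion D.le m)).symm.trans (hwp m))

/-- The restriction to `N` of a representation containing `ψ` contains `A`. -/
lemma exists_intertwiner_of_eigenvector [Finite G]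
    (hψ : ψ.comp (Subgroup.inclusion D.le) = θ)
    (hA : A.ρ.IsIrreducible) (hAψ : LiesOver (Subgroup.inclusion D.le') ψ A)
    (i : Rep.res (Subgroup.inclusion (le_sup_right : N ≤ C ⊔ N)) B ≅ A)
    {V : Type*} [AddCommGroup V] [Module ℂ V]
    {ρ : Representation ℂ G V} {v : V} (hv : v ≠ 0) (h : ∀ x : H, ρ x v = (ψ x : ℂ) • v) :
    ∃ f : B.V →ₗ[ℂ] V, f ≠ 0 ∧
      ∀ (k : N) w, f (B.ρ (Subgroup.inclusion le_sup_right k) w) = ρ k (f w) := by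
  let p : Submodule ℂ V :=
    { carrier := {w | ∀ x : H, ρ x w = (ψ x : ℂ) • w}
      add_mem' := fun ha hb x => by rw [map_add, ha x, hb x, smul_add]
      zero_mem' := fun x => by simp
      smul_mem' := fun c w hw x => by rw [map_smul, hw x, smul_comm] }
  have hp : ∀ k : N, ∀ w ∈ p, ρ k w ∈ p := by
    intro k w hw x
    obtain ⟨x', hx', hψx⟩ := D.conj_mem hψ k x
    have h2 : (x : G) * k = k * x' := by
      have h3 : (k : G)⁻¹ * x * k = x' := congrArg Subtype.val hx'
      rw [← h3]
      group
    rw [← Module.End.mul_apply, ← map_mul, h2, map_mul, Module.End.mul_apply, hw x', map_smul, hψx]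
  obtain ⟨q, hqp, hq⟩ := exists_irreducible_le
    (ρ := (ρ.comp N.subtype : Representation ℂ N V)) p hp h hv
  have := nontrivial_of_irreducible hq
  obtain ⟨w, hw⟩ := exists_ne (0 : q.toSubmodule)
  have hB := irreducible_of_extension hA i
  have := nontrivial_of_irreducible hB
  obtain ⟨b, hb⟩ := exists_ne (0 : B.V)
  -- An irreducible `N`-constituent of the `ψ`-eigenspace lies over `ψ`, so uniqueness identifies it
  -- with the restriction of `B`.
  obtain ⟨e⟩ := D.equiv_of_liesOver hψ hB hq hb
    (fun x => D.apply_eq_smul_of_extension hψ hA hAψ i x b) hw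
    (fun x => Subtype.ext (hqp w.2 x))
  refine ⟨q.toSubmodule.subtype ∘ₗ e.toLinearEquiv.toLinearMap, fun h0 => hb ?_, fun k w => ?_⟩
  · apply e.toLinearEquiv.injective
    rw [map_zero]
    exact Subtype.ext (congrArg (fun f : B.V →ₗ[ℂ] V => f b) h0)
  · exact congrArg Subtype.val (equiv_apply_rho e k w)

/-- The group $CN$ acts on $\mathrm{Hom}_N(B,V)$ through the abelian quotient $CN/N$. A common
eigenvector `g` there, with character `χ'`, is a $CN$-map from the twist of `B` by `χ'`. -/
lemma exists_twist_map [Finite G]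
    {V : Type*} [AddCommGroup V] [Module ℂ V]
    {ρ : Representation ℂ G V} {f : B.V →ₗ[ℂ] V} (hf0 : f ≠ 0)
    (hf : ∀ (k : N) w, f (B.ρ (Subgroup.inclusion le_sup_right k) w) = ρ k (f w)) :
    ∃ (χ : C ⧸ N.subgroupOf C →* ℂˣ) (f : B.V →ₗ[ℂ] V), f ≠ 0 ∧
      ∀ (t : (C ⊔ N : Subgroup G)) w, f (twist (inflateChar C N χ) B.ρ t w) = ρ t (f w) := by
  let R : Representation ℂ (C ⊔ N : Subgroup G) (B.V →ₗ[ℂ] V) :=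
    Representation.linHom B.ρ (ρ.comp (C ⊔ N).subtype)
  have hR : ∀ t f w, R t f w = ρ t (f (B.ρ t⁻¹ w)) := fun t f w => rfl
  have hBinv : ∀ t w, B.ρ t⁻¹ (B.ρ t w) = w := fun t w => by
    rw [← Module.End.mul_apply, ← map_mul, inv_mul_cancel, map_one]
    rfl
  let j := Subgroup.inclusion (le_sup_right : N ≤ C ⊔ N)
  let p : Submodule ℂ (B.V →ₗ[ℂ] V) :=
    { carrier := {f | ∀ k : N, R (j k) f = f}
      add_mem' := fun ha hb x => by rw [map_add, ha x, hb x]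
      zero_mem' := fun x => by simp
      smul_mem' := fun c w hw x => by rw [map_smul, hw x] }
  have hfp : f ∈ p := by
    intro k
    refine LinearMap.ext fun w => ?_
    rw [hR]
    change ρ k _ = _
    rw [← hf, ← Module.End.mul_apply, ← map_mul, mul_inv_cancel, map_one]
    rfl
  have hp : ∀ t, ∀ f ∈ p, R t f ∈ p := by
    intro t f hf k
    have h1 := hf (MulAut.conjNormal (t : G)⁻¹ k)
    have h2 : j k * t = t * j (MulAut.conjNormal (t : G)⁻¹ k) := Subtype.ext (by
      change (k : G) * t = t * (MulAut.conjNormal (t : G)⁻¹ k : N)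
      rw [MulAut.conjNormal_apply]
      group)
    rw [← Module.End.mul_apply, ← map_mul, h2, map_mul, Module.End.mul_apply, h1]
  obtain ⟨χ', g, hgp, hg0, hg⟩ := exists_common_eigenvector (ρ := R) p hp hfp hf0
    fun s t f hf => by
      have h1 : s * t = t * s * j ⟨_, commutator_mem_of_mem_sup D.comm s.2 t.2⟩ := Subtype.ext (by
        change (s : G) * t = t * s * ((s : G)⁻¹ * (t : G)⁻¹ * s * t)
        group)
      rw [← Module.End.mul_apply, ← map_mul, h1, map_mul, map_mul, Module.End.mul_apply, hf,
        Module.End.mul_apply]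
  obtain ⟨χ, hχ⟩ := exists_inflateChar_eq χ' fun k => by
    have h1 := (hg (j k)).symm.trans (hgp k)
    refine Units.ext (smul_left_injective ℂ hg0 ?_)
    change (χ' (j k) : ℂ) • g = (1 : ℂ) • g
    rw [h1, one_smul]
  refine ⟨χ, g, hg0, fun t w => ?_⟩
  have h1 := congrArg (fun f : B.V →ₗ[ℂ] V => f (B.ρ t w)) (hg t)
  change R t g (B.ρ t w) = (χ' t : ℂ) • g (B.ρ t w) at h1
  rw [hR, hBinv] at h1
  rw [h1, hχ, twist_apply, map_smul]

/-- Frobenius reciprocity turns `f` into a nonzero map between irreducible representations, giving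
surjectivity of the parametrization. -/
lemma repClass_ind_eq [Finite G] (χ : C ⧸ N.subgroupOf C →* ℂˣ)
    (hψ : ψ.comp (Subgroup.inclusion D.le) = θ)
    (hA : A.ρ.IsIrreducible) (hAψ : LiesOver (Subgroup.inclusion D.le') ψ A)
    (i : Rep.res (Subgroup.inclusion (le_sup_right : N ≤ C ⊔ N)) B ≅ A)
    {S : Rep.{u} ℂ G} (hS : S.ρ.IsIrreducible) {f : B.V →ₗ[ℂ] S.V} (hf0 : f ≠ 0)
    (hf : ∀ (t : (C ⊔ N : Subgroup G)) w,
      f (twist (inflateChar C N χ) B.ρ t w) = S.ρ t (f w)) :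
    repClass (Rep.ind (C ⊔ N).subtype (charTensor (inflateChar C N χ) B)) = repClass S := by
  obtain ⟨e, he⟩ := exists_charTensor_equiv (inflateChar C N χ) B
  obtain ⟨F, hF, hF1⟩ := exists_ind_map (σ := (charTensor (inflateChar C N χ) B).ρ) (ρ := S.ρ)
    (f ∘ₗ e.toLinearMap) fun t w => by
      change f (e ((charTensor (inflateChar C N χ) B).ρ t w)) = _
      rw [he, hf]
      rfl
  obtain ⟨b, hb⟩ : ∃ b, f b ≠ 0 := by
    by_contra h
    push Not at h
    exact hf0 (LinearMap.ext h)
  obtain ⟨E, -⟩ := equiv_of_irreducible (D.ind_charTensor_irreducible χ hψ hA hAψ i) hS F hF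
    (v := Representation.IndV.mk (C ⊔ N).subtype _ 1 (e.symm b)) (by
      rw [hF1]
      simpa using hb)
  exact repClass_eq_iff.2 ⟨E⟩

/-- The parametrization of the irreducible representations of `G` lying over `θ`. -/
theorem bijOn_ind [Finite G] {Y : Set (H →* ℂˣ)}
    (hY : Y = {ψ | ψ.comp (Subgroup.inclusion D.le) = θ})
    (π : Y → Rep.{u} ℂ N) (πext : Y → Rep.{u} ℂ (C ⊔ N : Subgroup G))
    (hπ : ∀ ψ, (π ψ).ρ.IsIrreducible ∧ LiesOver (Subgroup.inclusion D.le') ψ.1 (π ψ))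
    (hext : ∀ ψ, Nonempty
      (Rep.res (Subgroup.inclusion (le_sup_right : N ≤ C ⊔ N)) (πext ψ) ≅ π ψ)) :
    Set.BijOn
      (fun p : (C ⧸ N.subgroupOf C →* ℂˣ) × Y =>
        repClass (Rep.ind (C ⊔ N).subtype (charTensor (inflateChar C N p.1) (πext p.2))))
      Set.univ (IrrOver M.subtype θ) := by
  subst hY
  refine ⟨?_, ?_, ?_⟩
  · rintro ⟨χ, ψ⟩ -
    exact D.ind_charTensor_mem χ ψ.2 (hπ ψ).1 (hπ ψ).2 (hext ψ).some
  · rintro ⟨χ, ψ⟩ - ⟨χ', ψ'⟩ - h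
    obtain rfl : ψ = ψ' := Subtype.ext (D.eq_of_ind_equiv ψ.2 ψ'.2 (hπ ψ).1 (hπ ψ).2 (hπ ψ').1
      (hπ ψ').2 (hext ψ).some (hext ψ').some h)
    obtain rfl := D.eq_of_ind_equiv_self ψ.2 (hπ ψ).1 (hπ ψ).2 (hext ψ).some h
    rfl
  · rintro _ ⟨S, hS, hSθ, rfl⟩
    obtain ⟨v, hv, h⟩ := (liesOver_iff _ _ _).1 hSθ
    obtain ⟨ψ, hψ, w, hw, hwψ⟩ := D.exists_eigenvector hv h
    let ψ₀ : {ψ : H →* ℂˣ | ψ.comp (Subgroup.inclusion D.le) = θ} := ⟨ψ, hψ⟩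
    obtain ⟨f, hf0, hf⟩ := D.exists_intertwiner_of_eigenvector hψ (hπ ψ₀).1 (hπ ψ₀).2
      (hext ψ₀).some hw hwψ
    obtain ⟨χ, g, hg0, hg⟩ := D.exists_twist_map hf0 hf
    exact ⟨(χ, ψ₀), Set.mem_univ _,
      D.repClass_ind_eq χ hψ (hπ ψ₀).1 (hπ ψ₀).2 (hext ψ₀).some hS hg0 hg⟩

end IsHeisenbergDatum


/-! ### Cyclic vectors and centralizers of regular matrices over a field -/

section CyclicVector

open Polynomial

variable {K : Type*} [Field K]

/-- There is a vector whose annihilating polynomials are the multiples of the minimal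
polynomial. -/
lemma exists_annihilator_eq_minpoly {V : Type*} [AddCommGroup V] [Module K V]
    [FiniteDimensional K V] (f : Module.End K V) :
    ∃ v : V, ∀ p : K[X], aeval f p v = 0 ↔ minpoly K f ∣ p := by
  classical
  have hμ : minpoly K f ≠ 0 := minpoly.ne_zero (Algebra.IsIntegral.isIntegral f)
  suffices h : ∀ q : K[X], q ∣ minpoly K f → ∃ v : V, ∀ p : K[X], aeval f p v = 0 ↔ q ∣ p from
    h _ dvd_rfl
  intro q
  induction q using UniqueFactorizationMonoid.induction_on_coprime with
  | h0 => exact fun h => absurd (zero_dvd_iff.1 h) hμ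
  | h1 hu => exact fun _ => ⟨0, fun p => by simp [hu.dvd]⟩
  | @hpr p k hp =>
    rintro ⟨s, hs⟩
    rcases k with _ | k
    · exact ⟨0, fun p => by simp⟩
    have hnd : ¬ minpoly K f ∣ p ^ k * s := by
      rw [hs, pow_succ, mul_assoc, mul_dvd_mul_iff_left (pow_ne_zero _ hp.ne_zero)]
      intro h
      have hs0 : s ≠ 0 := fun h0 => hμ (by rw [hs, h0, mul_zero])
      have h' : p * s ∣ 1 * s := by rwa [one_mul]
      exact hp.not_isUnit (isUnit_of_dvd_one ((mul_dvd_mul_iff_right hs0).1 h'))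
    have hne : aeval f (p ^ k * s) ≠ 0 := fun h => hnd (minpoly.dvd K f h)
    obtain ⟨u, hu⟩ : ∃ u, aeval f (p ^ k * s) u ≠ 0 := by
      by_contra h
      push Not at h
      exact hne (LinearMap.ext h)
    -- Applying the cofactor `s` puts the vector in the kernel of $p^{k+1}(f)$, and the choice of
    -- `u` keeps it out of the kernel of $p^k(f)$; its annihilator is thus exactly $p^{k+1}$.
    refine ⟨aeval f s u, fun g => ⟨fun hg => ?_, ?_⟩⟩
    · obtain ⟨i, hi, hass⟩ := (dvd_prime_pow hp (k + 1)).1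
        (EuclideanDomain.gcd_dvd_right g (p ^ (k + 1)))
      have hz : aeval f (EuclideanDomain.gcd g (p ^ (k + 1))) (aeval f s u) = 0 := by
        have h1 : aeval f (p ^ (k + 1)) (aeval f s u) = 0 := by
          rw [← Module.End.mul_apply, ← map_mul, ← hs, minpoly.aeval, LinearMap.zero_apply]
        rw [EuclideanDomain.gcd_eq_gcd_ab, map_add, LinearMap.add_apply, mul_comm g,
          mul_comm (p ^ (k + 1)), map_mul, map_mul, Module.End.mul_apply, Module.End.mul_apply,
          hg, h1, map_zero, map_zero, add_zero]
      obtain ⟨c, hc⟩ := hass.dvd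
      have hz' : aeval f (p ^ i) (aeval f s u) = 0 := by
        rw [hc, mul_comm, map_mul, Module.End.mul_apply, hz, map_zero]
      rcases Nat.lt_or_ge i (k + 1) with hlt | hge
      · obtain ⟨d, rfl⟩ := Nat.exists_eq_add_of_le (Nat.lt_succ_iff.1 hlt)
        refine absurd ?_ hu
        rw [pow_add, mul_comm (p ^ i), mul_assoc, map_mul, map_mul, Module.End.mul_apply,
          Module.End.mul_apply, hz', map_zero]
      · obtain rfl : i = k + 1 := le_antisymm hi hge
        exact hass.symm.dvd.trans (EuclideanDomain.gcd_dvd_left _ _)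
    · rintro ⟨t, rfl⟩
      rw [← Module.End.mul_apply, ← map_mul, mul_right_comm, ← hs, map_mul, minpoly.aeval, zero_mul,
        LinearMap.zero_apply]
  | @hcp a b hab iha ihb =>
    intro h
    obtain ⟨v, hv⟩ := iha ((dvd_mul_right a b).trans h)
    obtain ⟨w, hw⟩ := ihb ((dvd_mul_left b a).trans h)
    have hcop : IsCoprime a b := hab.isCoprime
    -- For coprime annihilators, applying `b` kills `w` and applying `a` kills `v`, so each
    -- condition is recovered from the sum.
    refine ⟨v + w, fun g => ⟨fun hg => ?_, fun hg => ?_⟩⟩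
    · rw [map_add] at hg
      refine hcop.mul_dvd ?_ ?_
      · refine hcop.dvd_of_dvd_mul_left ((hv (b * g)).1 ?_)
        have := congrArg (aeval f b) hg
        rwa [map_add, ← Module.End.mul_apply, ← Module.End.mul_apply, ← map_mul,
          (hw (b * g)).2 (dvd_mul_right _ _), add_zero, map_zero] at this
      · refine hcop.symm.dvd_of_dvd_mul_left ((hw (a * g)).1 ?_)
        have := congrArg (aeval f a) hg
        rwa [map_add, ← Module.End.mul_apply, ← Module.End.mul_apply, ← map_mul,
          (hv (a * g)).2 (dvd_mul_right _ _), zero_add, map_zero] at this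
    · rw [map_add, (hv g).2 ((dvd_mul_right a b).trans hg), (hw g).2 ((dvd_mul_left b a).trans hg),
        add_zero]

/-- A matrix whose characteristic polynomial is its minimal polynomial generates its own
centralizer. -/
lemma exists_aeval_eq_of_commute {n : ℕ} {A : Matrix (Fin n) (Fin n) K}
    (hA : A.charpoly = minpoly K A) {X : Matrix (Fin n) (Fin n) K} (hX : A * X = X * A) :
    ∃ p : K[X], X = aeval A p := by
  let e := Matrix.toLinAlgEquiv' (R := K) (n := Fin n)
  let f : Module.End K (Fin n → K) := e A
  have hmin : minpoly K f = minpoly K A := minpoly.algEquiv_eq e A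
  obtain ⟨v, hv⟩ := exists_annihilator_eq_minpoly f
  have hdeg : (minpoly K f).natDegree = n := by
    rw [hmin, ← hA, Matrix.charpoly_natDegree_eq_dim, Fintype.card_fin]
  have hmonic : (minpoly K f).Monic := minpoly.monic (Algebra.IsIntegral.isIntegral f)
  -- The minimal polynomial has degree `n`, so evaluation at `v` is injective on polynomials of
  -- degree below `n`; by dimension it is onto and `v` is cyclic.
  let T : degreeLT K n →ₗ[K] (Fin n → K) :=
    (LinearMap.applyₗ v ∘ₗ (aeval f).toLinearMap) ∘ₗ (degreeLT K n).subtype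
  have hT : Function.Injective T := by
    rw [injective_iff_map_eq_zero]
    rintro ⟨p, hp⟩ hp0
    have hd : minpoly K f ∣ p := (hv p).1 hp0
    have : p = 0 := by
      by_contra h0
      have h1 := natDegree_le_of_dvd hd h0
      have h2 := mem_degreeLT.1 hp
      rw [degree_eq_natDegree h0, Nat.cast_lt] at h2
      omega
    exact Subtype.ext this
  have hsurj : Function.Surjective T := by
    refine (LinearMap.injective_iff_surjective_of_finrank_eq_finrank ?_).1 hT
    rw [LinearEquiv.finrank_eq (degreeLTEquiv K n)]
  have hcyc : ∀ w, ∃ p : K[X], aeval f p v = w := fun w => by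
    obtain ⟨p, hp⟩ := hsurj w
    exact ⟨p, hp⟩
  have hcomm : ∀ p : K[X], Commute (e X) (aeval f p) := by
    intro p
    have h1 : Commute f (e X) := by
      change e A * e X = e X * e A
      rw [← map_mul, hX, map_mul]
    exact (Algebra.commute_of_mem_adjoin_singleton_of_commute
      (aeval_mem_adjoin_singleton K f) h1.symm)
  -- Both `X` and $p(A)$ commute with every polynomial in `A` and they agree on the cyclic vector,
  -- hence everywhere.
  obtain ⟨p, hp⟩ := hcyc (e X v)
  refine ⟨p, e.injective ?_⟩
  rw [show e (aeval A p) = aeval f p from (aeval_algHom_apply e A p).symm]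
  refine LinearMap.ext fun w => ?_
  obtain ⟨q, rfl⟩ := hcyc w
  rw [← Module.End.mul_apply, (hcomm q).eq, Module.End.mul_apply, ← hp, ← Module.End.mul_apply,
    ← Module.End.mul_apply, ← map_mul, ← map_mul, mul_comm]

end CyclicVector

/-! ### Matrices over a discrete valuation ring: centralizers, congruence subgroups, commutators -/

section Arithmetic

open Polynomial

variable {O : Type u} [CommRing O] [IsDomain O] [IsDiscreteValuationRing O] {n : ℕ} {ϖ : O}

lemma red_eq_iff (hϖ : Irreducible ϖ) {i : ℕ} {X Y : Matrix (Fin n) (Fin n) O} :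
    red i X = red i Y ↔ ∃ Z, X = Y + ϖ ^ i • Z := by
  constructor
  · intro h
    have hd : ∀ a b, ∃ z : O, X a b - Y a b = ϖ ^ i * z := fun a b =>
      (mem_pow_iff hϖ).1 (Ideal.Quotient.eq.1 (congrFun (congrFun h a) b))
    choose Z hZ using hd
    refine ⟨Matrix.of Z, ?_⟩
    ext a b
    simp [← hZ]
  · rintro ⟨Z, rfl⟩
    ext a b
    refine Ideal.Quotient.eq.2 ((mem_pow_iff hϖ).2 ⟨Z a b, ?_⟩)
    simp

lemma bar_eq_iff (hϖ : Irreducible ϖ) {X Y : Matrix (Fin n) (Fin n) O} :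
    bar X = bar Y ↔ ∃ Z, X = Y + ϖ • Z := by
  constructor
  · intro h
    have hd : ∀ a b, ∃ z : O, X a b - Y a b = ϖ * z := fun a b => by
      have h1 := congrFun (congrFun h a) b
      have h2 : IsLocalRing.residue O (X a b - Y a b) = 0 := by
        rw [map_sub, sub_eq_zero]
        exact h1
      rw [IsLocalRing.residue_eq_zero_iff, hϖ.maximalIdeal_eq, Ideal.mem_span_singleton] at h2
      exact h2
    choose Z hZ using hd
    refine ⟨Matrix.of Z, ?_⟩
    ext a b
    simp [← hZ]
  · rintro ⟨Z, rfl⟩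
    have h := bar_smul_pow hϖ one_pos Z
    rw [pow_one] at h
    rw [bar_add, h, add_zero]

lemma bar_mul (X Y : Matrix (Fin n) (Fin n) O) : bar (X * Y) = bar X * bar Y :=
  Matrix.map_mul

lemma bar_aeval (β : Matrix (Fin n) (Fin n) O) (f : O[X]) :
    bar (aeval β f) = aeval (bar β) (f.map (IsLocalRing.residue O)) :=
  map_aeval_eq_aeval_map (ψ := (IsLocalRing.residue O).mapMatrix) (φ := IsLocalRing.residue O)
    (by
      ext x a b
      by_cases h : a = b <;> simp [Matrix.algebraMap_matrix_apply, h]) f β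

lemma red_aeval (r : ℕ) (β : Matrix (Fin n) (Fin n) O) (f : O[X]) :
    red r (aeval β f) =
      aeval (red r β) (f.map (Ideal.Quotient.mk (IsLocalRing.maximalIdeal O ^ r))) :=
  map_aeval_eq_aeval_map (ψ := (Ideal.Quotient.mk (IsLocalRing.maximalIdeal O ^ r)).mapMatrix)
    (φ := Ideal.Quotient.mk (IsLocalRing.maximalIdeal O ^ r))
    (by
      ext x a b
      by_cases h : a = b <;> simp [Matrix.algebraMap_matrix_apply, h]) f β

lemma exists_aeval_bar_eq {β X : Matrix (Fin n) (Fin n) O} (h : bar X ∈ resAlg β) :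
    ∃ f : O[X], bar X = bar (aeval β f) := by
  have h' : bar X ∈ Algebra.adjoin (IsLocalRing.ResidueField O) {bar β} := h
  rw [Algebra.adjoin_singleton_eq_range_aeval] at h'
  obtain ⟨p, hp⟩ := h'
  obtain ⟨f, rfl⟩ := Polynomial.map_surjective _ IsLocalRing.residue_surjective p
  exact ⟨f, by rw [bar_aeval]; exact hp.symm⟩

/-- The centralizer of a regular matrix is the algebra it generates; this identifies the radical of
the commutator pairing. -/
lemma mem_resAlg_iff {β : Matrix (Fin n) (Fin n) O} (hβ : IsRegularMat β)
    (X : Matrix (Fin n) (Fin n) O) : bar X ∈ resAlg β ↔ bar β * bar X = bar X * bar β := by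
  constructor
  · intro h
    have h' : bar X ∈ Algebra.adjoin (IsLocalRing.ResidueField O) {bar β} := h
    exact Algebra.commute_of_mem_adjoin_self h'
  · intro h
    obtain ⟨p, hp⟩ := exists_aeval_eq_of_commute hβ h
    rw [hp]
    exact aeval_mem_adjoin_singleton _ _

/-- A matrix commuting with a regular matrix `β` modulo `𝔭^i` is a polynomial in `β` modulo
`𝔭^i`. -/
lemma exists_aeval_of_commute (hϖ : Irreducible ϖ) {β : Matrix (Fin n) (Fin n) O}
    (hβ : IsRegularMat β) (i : ℕ) (X : Matrix (Fin n) (Fin n) O)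
    (h : ∃ Z, β * X = X * β + ϖ ^ i • Z) :
    ∃ (f : O[X]) (Z : Matrix (Fin n) (Fin n) O), X = aeval β f + ϖ ^ i • Z := by
  induction i generalizing X with
  | zero => exact ⟨0, X, by simp⟩
  | succ i ih =>
    obtain ⟨Z, hZ⟩ := h
    have h1 : bar β * bar X = bar X * bar β := by
      rw [← bar_mul, ← bar_mul]
      exact (bar_eq_iff hϖ).2 ⟨ϖ ^ i • Z, by rw [hZ, smul_smul, ← pow_succ']⟩
    obtain ⟨f, hf⟩ := exists_aeval_bar_eq ((mem_resAlg_iff hβ X).2 h1)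
    obtain ⟨X', hX'⟩ := (bar_eq_iff hϖ).1 hf
    have hc : β * aeval β f = aeval β f * β :=
      Algebra.commute_of_mem_adjoin_self (aeval_mem_adjoin_singleton O β)
    -- With $X=f(\beta)+\varpi X'$, cancelling `ϖ` shows that `X'` commutes with `β` modulo one
    -- power less, so the induction hypothesis applies to it.
    have h2 : ϖ • (β * X') = ϖ • (X' * β + ϖ ^ i • Z) := by
      rw [hX', mul_add, add_mul, hc, add_assoc, add_right_inj, mul_smul_comm, smul_mul_assoc] at hZ
      rw [hZ, smul_add, smul_smul, ← pow_succ']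
    obtain ⟨g, Z', hZ'⟩ := ih X' ⟨Z, smul_right_injective _ hϖ.ne_zero h2⟩
    refine ⟨f + Polynomial.C ϖ * g, Z', ?_⟩
    rw [hX', hZ', smul_add, smul_smul, ← pow_succ', map_add, map_mul, aeval_C,
      ← Algebra.smul_def, add_assoc]

lemma exists_red_eq {r : ℕ} (A : Matrix (Fin n) (Fin n) (Level O r)) : ∃ X, A = red r X := by
  have hlift : ∀ a b, ∃ x : O, Ideal.Quotient.mk ((IsLocalRing.maximalIdeal O) ^ r) x = A a b :=
    fun a b => Ideal.Quotient.mk_surjective _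
  choose X hX using hlift
  exact ⟨Matrix.of X, Matrix.ext fun a b => (hX a b).symm⟩

lemma isUnit_det_bar_iff (X : Matrix (Fin n) (Fin n) O) : IsUnit (bar X).det ↔ IsUnit X.det := by
  have h : (bar X).det = IsLocalRing.residue O X.det :=
    ((IsLocalRing.residue O).map_det X).symm
  rw [h, isUnit_iff_ne_zero, IsLocalRing.residue_ne_zero_iff_isUnit]

lemma exists_gl (r : ℕ) {X : Matrix (Fin n) (Fin n) O} (hX : IsUnit (bar X).det) :
    ∃ g : G O n r, (g : Matrix (Fin n) (Fin n) (Level O r)) = red r X := by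
  obtain ⟨u, hu⟩ := (Matrix.isUnit_iff_isUnit_det _).2 ((isUnit_det_bar_iff X).1 hX)
  refine ⟨Units.map (Ideal.Quotient.mk (IsLocalRing.maximalIdeal O ^ r)).mapMatrix.toMonoidHom u, ?_⟩
  rw [← hu]
  rfl

lemma isUnit_det_bar_of_gl (hϖ : Irreducible ϖ) {r : ℕ} (hr : 0 < r) {g : G O n r}
    {X : Matrix (Fin n) (Fin n) O} (hg : (g : Matrix (Fin n) (Fin n) (Level O r)) = red r X) :
    IsUnit (bar X).det := by
  obtain ⟨X', hX'⟩ := exists_red_eq (g⁻¹ : G O n r).val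
  have h1 : red r (X * X') = red r 1 := by
    rw [red_mul, red_one, ← hg, ← hX', ← Units.val_mul, mul_inv_cancel, Units.val_one]
  obtain ⟨Z, hZ⟩ := (red_eq_iff hϖ).1 h1
  have h2 : bar X * bar X' = 1 := by
    rw [← bar_mul, hZ, bar_add, bar_smul_pow hϖ hr, add_zero]
    exact Matrix.map_one _ (map_zero _) (map_one _)
  exact IsUnit.of_mul_eq_one (bar X').det (by rw [← Matrix.det_mul, h2, Matrix.det_one])

lemma map_val_eq {i r : ℕ} (h : i ≤ r) {g : G O n r} {X : Matrix (Fin n) (Fin n) O}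
    (hg : (g : Matrix (Fin n) (Fin n) (Level O r)) = red r X) :
    (Matrix.GeneralLinearGroup.map (n := Fin n)
      (Ideal.Quotient.factorPow (IsLocalRing.maximalIdeal O) h) g).val = red i X := by
  ext a b
  rw [Matrix.GeneralLinearGroup.map_apply, hg]
  rfl

lemma red_eq_of_le (hϖ : Irreducible ϖ) {i r : ℕ} (h : i ≤ r) {X Y : Matrix (Fin n) (Fin n) O}
    (hXY : red r X = red r Y) : red i X = red i Y := by
  obtain ⟨Z, hZ⟩ := (red_eq_iff hϖ).1 hXY
  refine (red_eq_iff hϖ).2 ⟨ϖ ^ (r - i) • Z, ?_⟩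
  rw [hZ, smul_smul, ← pow_add, Nat.add_sub_cancel' h]

lemma mem_K_iff {i r : ℕ} (h : i ≤ r) {g : G O n r} {X : Matrix (Fin n) (Fin n) O}
    (hg : (g : Matrix (Fin n) (Fin n) (Level O r)) = red r X) :
    g ∈ K O n h ↔ red i X = 1 := by
  rw [← map_val_eq h hg, ← Units.val_one, Units.val_inj]
  rfl

lemma IsCoeff.mem_K (hϖ : Irreducible ϖ) {i r : ℕ} (h : i ≤ r) {g : G O n r}
    {X : Matrix (Fin n) (Fin n) O} (hg : IsCoeff ϖ i g X) : g ∈ K O n h := by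
  rw [mem_K_iff h hg, ← red_one, red_eq_iff hϖ]
  exact ⟨X, rfl⟩

lemma exists_isCoeff (hϖ : Irreducible ϖ) {i : ℕ} (r : ℕ) (hi : 0 < i)
    (X : Matrix (Fin n) (Fin n) O) : ∃ g : G O n r, IsCoeff ϖ i g X := by
  refine exists_gl r ?_
  rw [bar_add, bar_smul_pow hϖ hi, add_zero]
  have : bar (1 : Matrix (Fin n) (Fin n) O) = 1 := Matrix.map_one _ (map_zero _) (map_one _)
  rw [this, Matrix.det_one]
  exact isUnit_one

lemma mem_KU_iff (hϖ : Irreducible ϖ) {i r : ℕ} (hi : 0 < i) (hir : i < r)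
    {U : Submodule (IsLocalRing.ResidueField O)
      (Matrix (Fin n) (Fin n) (IsLocalRing.ResidueField O))} {g : G O n r}
    {X : Matrix (Fin n) (Fin n) O} (hg : IsCoeff ϖ i g X) :
    g ∈ KU hϖ hi hir U ↔ bar X ∈ U := by
  have h1 := coeffHom_eq hϖ hi hir ⟨g, hg.mem_K hϖ hir.le⟩ hg
  constructor
  · rintro ⟨k, hk, rfl⟩
    have h2 : coeffHom hϖ hi hir k ∈ AddSubgroup.toSubgroup U.toAddSubgroup := hk
    rw [show k = ⟨K O n hir.le |>.subtype k, hg.mem_K hϖ hir.le⟩ from rfl, h1] at h2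
    exact h2
  · intro h
    refine ⟨⟨g, hg.mem_K hϖ hir.le⟩, ?_, rfl⟩
    change coeffHom hϖ hi hir _ ∈ AddSubgroup.toSubgroup U.toAddSubgroup
    rw [h1]
    exact h

/-- In a finite group the inverse is a power, so membership of the inverse in the subalgebra is
automatic. -/
lemma mem_C_iff {r : ℕ} [Finite (G O n r)] {β : Matrix (Fin n) (Fin n) O} {g : G O n r} :
    g ∈ C r β ↔ g.val ∈ Algebra.adjoin (Level O r) {red r β} := by
  constructor
  · exact fun h => h.1
  · intro h
    refine ⟨h, ?_⟩
    have h1 : g⁻¹ = g ^ (Nat.card (G O n r) - 1) := by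
      rw [inv_eq_iff_mul_eq_one, ← pow_succ', Nat.sub_add_cancel Nat.card_pos, pow_card_eq_one']
    have h2 : (g⁻¹ : G O n r).val ∈ Algebra.adjoin (Level O r) {red r β} := by
      rw [h1, Units.val_pow_eq_pow_val]
      exact pow_mem h _
    exact h2

lemma C_comm {r : ℕ} {β : Matrix (Fin n) (Fin n) O} {g h : G O n r} (hg : g ∈ C r β)
    (hh : h ∈ C r β) : g * h = h * g :=
  Units.ext (Algebra.commute_of_mem_adjoin_singleton_of_commute hh.1
    (Algebra.commute_of_mem_adjoin_self hg.1).symm)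

/-- For regular `β`, the elements of `G_r` commuting with `β` modulo `𝔭^i` form `𝒞 K_i`. -/
lemma mem_C_sup_K_iff (hϖ : Irreducible ϖ) {i r : ℕ} (hi : 0 < i) (hir : i ≤ r)
    [Finite (G O n r)] {β : Matrix (Fin n) (Fin n) O} (hβ : IsRegularMat β) {g : G O n r}
    {X : Matrix (Fin n) (Fin n) O} (hg : (g : Matrix (Fin n) (Fin n) (Level O r)) = red r X) :
    g ∈ C r β ⊔ K O n hir ↔ red i (β * X) = red i (X * β) := by
  constructor
  · intro h
    obtain ⟨c, hc, k, hk, rfl⟩ := Subgroup.mem_sup_of_normal_right.1 h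
    obtain ⟨Y, hY⟩ := exists_red_eq c.val
    have h1 : red i X = red i Y := by
      have hk' : Matrix.GeneralLinearGroup.map (n := Fin n)
        (Ideal.Quotient.factorPow (IsLocalRing.maximalIdeal O) hir) k = 1 := hk
      rw [← map_val_eq hir hg, ← map_val_eq hir hY, map_mul, hk', mul_one]
    have h2 : red r (β * Y) = red r (Y * β) := by
      rw [red_mul, red_mul, ← hY]
      exact Algebra.commute_of_mem_adjoin_self hc.1
    rw [red_mul, red_mul, h1, ← red_mul, ← red_mul]
    exact red_eq_of_le hϖ hir h2
  · intro h
    -- The polynomial $f(\beta)$ agrees with the invertible `X` modulo $\mathfrak p$, so it defines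
    -- an element of $\mathcal C$ congruent to `g` modulo $\mathfrak p^i$.
    obtain ⟨f, Z, hf⟩ := exists_aeval_of_commute hϖ hβ i X ((red_eq_iff hϖ).1 h)
    have h1 := isUnit_det_bar_of_gl hϖ (hi.trans_le hir) hg
    rw [hf, bar_add, bar_smul_pow hϖ hi, add_zero] at h1
    obtain ⟨c, hc⟩ := exists_gl r h1
    have hcC : c ∈ C r β := mem_C_iff.2 (by
      rw [hc, red_aeval]
      exact aeval_mem_adjoin_singleton _ _)
    have hk : c⁻¹ * g ∈ K O n hir := by
      change Matrix.GeneralLinearGroup.map (n := Fin n)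
        (Ideal.Quotient.factorPow (IsLocalRing.maximalIdeal O) hir) (c⁻¹ * g) = 1
      rw [map_mul, map_inv, inv_mul_eq_one]
      apply Units.ext
      rw [map_val_eq hir hc, map_val_eq hir hg]
      exact (red_eq_iff hϖ).2 ⟨-Z, by rw [hf, smul_neg, add_neg_cancel_right]⟩
    rw [← mul_inv_cancel_left c g]
    exact mul_mem ((le_sup_left : C r β ≤ _) hcC) ((le_sup_right : K O n hir ≤ _) hk)

/-- The commutator of two elements of `K_i`, for `3i ≥ r`. -/
lemma IsCoeff.commutator (hϖ : Irreducible ϖ) {i j d r : ℕ} (hij : j + d = 2 * i) (hr : r ≤ 3 * i)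
    {a b : G O n r} {X Y : Matrix (Fin n) (Fin n) O} (ha : IsCoeff ϖ i a X)
    (hb : IsCoeff ϖ i b Y) :
    IsCoeff ϖ j (b * a * b⁻¹ * a⁻¹) (ϖ ^ d • (Y * X - X * Y)) := by
  have h1 : red r (1 + ϖ ^ j • ϖ ^ d • (Y * X - X * Y)) * (a * b).val = (b * a).val := by
    rw [Units.val_mul, Units.val_mul, ha, hb, ← red_mul, ← red_mul, ← red_mul, red_eq_iff hϖ]
    -- Exactly, $(1+\varpi^{2i}D)(1+\varpi^iX)(1+\varpi^iY)$ exceeds $(1+\varpi^iY)(1+\varpi^iX)$ by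
    -- $\varpi^{3i}D(X+Y+\varpi^iXY)$, where $D=YX-XY$; this vanishes modulo $\mathfrak p^r$.
    refine ⟨ϖ ^ (3 * i - r) • ((Y * X - X * Y) * (X + Y + ϖ ^ i • (X * Y))), ?_⟩
    rw [smul_smul, smul_smul, ← pow_add, ← pow_add, hij, Nat.add_sub_cancel' hr, two_mul,
      show 3 * i = i + i + i by ring, pow_add, pow_add, pow_add]
    generalize ϖ ^ i = p
    simp only [add_mul, mul_add, sub_mul, smul_add, smul_sub, smul_mul_assoc,
      mul_smul_comm, smul_smul, one_mul, mul_one, mul_assoc]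
    abel
  unfold IsCoeff
  rw [show b * a * b⁻¹ * a⁻¹ = (b * a) * (a * b)⁻¹ by group, Units.val_mul, ← h1, mul_assoc,
    ← Units.val_mul, mul_inv_cancel, Units.val_one, mul_one]

lemma IsCoeff.conj {i r : ℕ} {g k : G O n r} {X X' Y : Matrix (Fin n) (Fin n) O}
    (hg : g.val = red r X) (hg' : (g⁻¹ : G O n r).val = red r X') (hk : IsCoeff ϖ i k Y) :
    IsCoeff ϖ i (g * k * g⁻¹) (X * Y * X') := by
  have h1 : red r (X * X') = 1 := by
    rw [red_mul, ← hg, ← hg', ← Units.val_mul, mul_inv_cancel, Units.val_one]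
  unfold IsCoeff at *
  rw [Units.val_mul, Units.val_mul, hg, hg', hk, ← red_mul, ← red_mul, mul_add, add_mul, mul_one,
    red_add, h1, red_add, red_one, mul_smul_comm, smul_mul_assoc]

end Arithmetic

/-! ### The stabilizer of the character and the radical of its commutator pairing -/

section LocalField

variable {F : Type u} [Field F] [ValuativeRel F] [TopologicalSpace F]
  [IsNonarchimedeanLocalField F] {n : ℕ} {ϖ : 𝒪[F]} {τ : AddChar F Circle}

instance finite_level (r : ℕ) : Finite (Level 𝒪[F] r) := by
  have : Finite (𝒪[F] ⧸ IsLocalRing.maximalIdeal 𝒪[F]) :=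
    inferInstanceAs (Finite (IsLocalRing.ResidueField 𝒪[F]))
  exact Ideal.finite_quotient_pow (IsNoetherian.noetherian _) r

instance finite_G (r : ℕ) : Finite (G 𝒪[F] n r) :=
  have : Finite (Matrix (Fin n) (Fin n) (Level 𝒪[F] r)) :=
    inferInstanceAs (Finite (Fin n → Fin n → Level 𝒪[F] r))
  inferInstance

/-- Nondegeneracy of the trace pairing. -/
lemma forall_tauTrace_eq_one_iff (hϖ : Irreducible ϖ)
    (hτ : ∀ x : F, (∀ y : 𝒪[F], τ (x * y) = 1) ↔ x ∈ 𝒪[F]) (m : ℕ)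
    (Z : Matrix (Fin n) (Fin n) 𝒪[F]) :
    (∀ X, tauTrace ϖ τ m Z X = 1) ↔ ∃ Z', Z = ϖ ^ m • Z' := by
  have h0 : (ϖ : F) ≠ 0 := fun h => hϖ.ne_zero (Subtype.ext h)
  constructor
  · intro h
    have hd : ∀ a b, ∃ z : 𝒪[F], Z a b = ϖ ^ m * z := by
      intro a b
      have h1 : ((ϖ : F) ^ m)⁻¹ * (Z a b : F) ∈ 𝒪[F] := by
        rw [← hτ]
        intro y
        -- A multiple of an elementary matrix isolates one entry of `Z`; letting `y` vary and using
        -- the conductor of `τ` gives its divisibility.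
        have h2 := h (Matrix.single b a y)
        unfold tauTrace at h2
        rw [Matrix.trace_single_mul] at h2
        have h3 : τ (((ϖ : F) ^ m)⁻¹ * ((y * Z a b : 𝒪[F]) : F)) = 1 :=
          Subtype.ext (congrArg Units.val h2)
        rw [← h3]
        push_cast
        ring_nf
      refine ⟨⟨_, h1⟩, Subtype.ext ?_⟩
      push_cast
      rw [mul_inv_cancel_left₀ (pow_ne_zero m h0)]
    choose Z' hZ' using hd
    refine ⟨Matrix.of Z', ?_⟩
    ext a b
    simp [hZ']
  · rintro ⟨Z', rfl⟩ X
    have h1 := tauTrace_smul hϖ hτ (le_refl m) Z' X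
    unfold tauTrace at *
    rwa [Matrix.mul_smul, ← Matrix.smul_mul]

omit [TopologicalSpace F] [IsNonarchimedeanLocalField F] in
lemma tauTrace_add_right (m : ℕ) (β β' X : Matrix (Fin n) (Fin n) 𝒪[F]) :
    tauTrace ϖ τ m (β + β') X = tauTrace ϖ τ m β X * tauTrace ϖ τ m β' X := by
  unfold tauTrace
  rw [mul_add, Matrix.trace_add, ← map_mul, ← AddChar.map_add_eq_mul, ← mul_add]
  rfl

/-- The stabilizer of `ψ_β`. -/
lemma psiBeta_conj_iff (hϖ : Irreducible ϖ)
    (hτ : ∀ x : F, (∀ y : 𝒪[F], τ (x * y) = 1) ↔ x ∈ 𝒪[F])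
    {l l' r : ℕ} (hr : l + l' = r) (hl : l' ≤ l) (hlr : l ≤ r) (hl0 : 0 < l)
    (β : Matrix (Fin n) (Fin n) 𝒪[F]) {g : G 𝒪[F] n r} {X : Matrix (Fin n) (Fin n) 𝒪[F]}
    (hg : g.val = red r X) :
    (∀ m, psiBeta hϖ hτ hr hl hlr β (MulAut.conjNormal g m) = psiBeta hϖ hτ hr hl hlr β m) ↔
      red l' (β * X) = red l' (X * β) := by
  obtain ⟨X', hX'⟩ := exists_red_eq (g⁻¹ : G 𝒪[F] n r).val
  have hl'r : l' ≤ r := hl.trans hlr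
  have h1 : red l' X * red l' X' = 1 := by
    rw [← map_val_eq hl'r hg, ← map_val_eq hl'r hX', ← Units.val_mul, ← map_mul, mul_inv_cancel,
      map_one, Units.val_one]
  have h1' : red l' X' * red l' X = 1 := by
    rw [← map_val_eq hl'r hg, ← map_val_eq hl'r hX', ← Units.val_mul, ← map_mul, inv_mul_cancel,
      map_one, Units.val_one]
  have hval : ∀ (m : K 𝒪[F] n hlr) (Y : Matrix (Fin n) (Fin n) 𝒪[F]), IsCoeff ϖ l m.1 Y →
      (psiBeta hϖ hτ hr hl hlr β (MulAut.conjNormal g m) = psiBeta hϖ hτ hr hl hlr β m ↔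
        tauTrace ϖ τ l' (X' * β * X - β) Y = 1) := by
    intro m Y hY
    have h2 : IsCoeff ϖ l (MulAut.conjNormal g m : K 𝒪[F] n hlr).1 (X * Y * X') := by
      rw [MulAut.conjNormal_apply]
      exact hY.conj hg hX'
    rw [psiBeta_eq hϖ hτ hr hl hlr β _ h2, psiBeta_eq hϖ hτ hr hl hlr β _ hY]
    -- Cyclicity of the trace transfers conjugation from the group element to `β`; the condition
    -- becomes $g^{-1}\beta g\equiv\beta$ modulo $\mathfrak p^{l'}$.
    have h3 : (X * Y * X' * β).trace = (Y * (X' * β * X)).trace := by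
      rw [mul_assoc, mul_assoc, Matrix.trace_mul_comm, mul_assoc]
    have h4 := tauTrace_add_right (ϖ := ϖ) (τ := τ) l' (X' * β * X - β) β Y
    rw [sub_add_cancel] at h4
    rw [h3]
    change tauTrace ϖ τ l' (X' * β * X) Y = tauTrace ϖ τ l' β Y ↔ _
    rw [h4, mul_eq_right]
  have h5 : (∀ m, psiBeta hϖ hτ hr hl hlr β (MulAut.conjNormal g m) =
      psiBeta hϖ hτ hr hl hlr β m) ↔ ∀ Y, tauTrace ϖ τ l' (X' * β * X - β) Y = 1 := by
    constructor
    · intro h Y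
      obtain ⟨m, hm⟩ := exists_isCoeff hϖ r hl0 Y
      exact (hval ⟨m, hm.mem_K hϖ hlr⟩ Y hm).1 (h _)
    · intro h m
      obtain ⟨Y, hY⟩ := exists_coeff hϖ m
      exact (hval m Y hY).2 (h Y)
  have h6 : (∃ Z', X' * β * X - β = ϖ ^ l' • Z') ↔ red l' (X' * β * X) = red l' β := by
    rw [red_eq_iff hϖ]
    simp only [sub_eq_iff_eq_add, add_comm]
  rw [h5, forall_tauTrace_eq_one_iff hϖ hτ, h6, red_mul, red_mul, red_mul, red_mul]
  constructor
  · intro h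
    rw [← h, ← mul_assoc, ← mul_assoc, h1, one_mul, h]
  · intro h
    rw [mul_assoc, h, ← mul_assoc, h1', one_mul]

/-- The value of `ψ_β` on commutators of elements of `K_{l'}`, for `r = 2l' + 1`. -/
lemma psiBeta_commutator (hϖ : Irreducible ϖ)
    (hτ : ∀ x : F, (∀ y : 𝒪[F], τ (x * y) = 1) ↔ x ∈ 𝒪[F])
    {l l' d r : ℕ} (hr : l + l' = r) (hl : l' ≤ l) (hlr : l ≤ r) (hd : l + d = 2 * l')
    (hd' : d + 1 = l') (hr3 : r ≤ 3 * l')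
    (β : Matrix (Fin n) (Fin n) 𝒪[F]) {a b : G 𝒪[F] n r} {X Y : Matrix (Fin n) (Fin n) 𝒪[F]}
    (ha : IsCoeff ϖ l' a X) (hb : IsCoeff ϖ l' b Y) (hmem : b * a * b⁻¹ * a⁻¹ ∈ K 𝒪[F] n hlr) :
    psiBeta hϖ hτ hr hl hlr β ⟨_, hmem⟩ = tauTrace ϖ τ 1 (X * β - β * X) Y := by
  have h0 : (ϖ : F) ≠ 0 := fun h => hϖ.ne_zero (Subtype.ext h)
  rw [psiBeta_eq hϖ hτ hr hl hlr β _ (ha.commutator hϖ hd hr3 hb)]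
  unfold tauTrace
  have h1 : ((Y * X - X * Y) * β).trace = (Y * (X * β - β * X)).trace := by
    rw [sub_mul, mul_sub, Matrix.trace_sub, Matrix.trace_sub, ← mul_assoc, ← mul_assoc, mul_assoc X,
      Matrix.trace_mul_comm X]
  rw [smul_mul_assoc, Matrix.trace_smul, h1, smul_eq_mul]
  -- Here $d=l'-1$, so $\varpi^{-l'}\varpi^d=\varpi^{-1}$: the pairing only sees matrices modulo
  -- $\mathfrak p$.
  congr 2
  push_cast
  rw [← hd', pow_succ, pow_one]
  field_simp

variable {r l : ℕ}

lemma Kl1_commutator_mem (hϖ : Irreducible ϖ) (hl : 2 ≤ l) (hr : r = 2 * l - 1)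
    {a b : G 𝒪[F] n r} (ha : a ∈ Kl1 F n hl hr) (hb : b ∈ Kl1 F n hl hr) :
    b * a * b⁻¹ * a⁻¹ ∈ Kl F n hl hr := by
  obtain ⟨X, hX⟩ := exists_coeff hϖ ⟨a, ha⟩
  obtain ⟨Y, hY⟩ := exists_coeff hϖ ⟨b, hb⟩
  exact (IsCoeff.commutator hϖ (j := l) (d := l - 2) (by omega) (by omega) hX hY).mem_K hϖ (by omega)

/-- Regularity enters twice: modulo $\mathfrak p^{l-1}$ for the stabilizer, and modulo $\mathfrak p$
for the radical. The condition $l\ge2$ gives $r\le3(l-1)$, which makes the commutator formula exact.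
-/
theorem isHeisenbergDatum (hϖ : Irreducible ϖ)
    (hτ : ∀ x : F, (∀ y : 𝒪[F], τ (x * y) = 1) ↔ x ∈ 𝒪[F])
    (hl : 2 ≤ l) (hr : r = 2 * l - 1) {β : Matrix (Fin n) (Fin n) 𝒪[F]} (hβ : IsRegularMat β) :
    IsHeisenbergDatum (C r β) (Kl1 F n hl hr) (KBeta hϖ hl hr β) (Kl F n hl hr)
      (psi hϖ hτ hl hr β) where
  le := Kl_le_KBeta hϖ hl hr β
  le' := KBeta_le_Kl1 hϖ hl hr β
  comm a ha b hb := C_comm ha hb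
  stabilizer g := by
    obtain ⟨X, hX⟩ := exists_red_eq g.val
    rw [mem_C_sup_K_iff hϖ (by omega) (by omega) hβ hX,
      psiBeta_conj_iff hϖ hτ _ _ _ (by omega) β hX]
  commutator_mem a ha b hb := Kl1_commutator_mem hϖ hl hr hb ha
  radical a ha := by
    obtain ⟨X, hX⟩ := exists_coeff hϖ ⟨a, ha⟩
    have hX' : IsCoeff ϖ (l - 1) a X := hX
    rw [mem_KU_iff hϖ _ _ hX', mem_resAlg_iff hβ, ← bar_mul, ← bar_mul, eq_comm, bar_eq_iff hϖ]
    have h1 : (∃ Z, X * β = β * X + ϖ • Z) ↔ ∃ Z, X * β - β * X = ϖ ^ 1 • Z := by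
      simp only [sub_eq_iff_eq_add, pow_one, add_comm]
    rw [h1, ← forall_tauTrace_eq_one_iff hϖ hτ]
    have hval : ∀ (b : G 𝒪[F] n r) (hb : b ∈ Kl1 F n hl hr) (Y : Matrix (Fin n) (Fin n) 𝒪[F]),
        IsCoeff ϖ (l - 1) b Y → psi hϖ hτ hl hr β
          ⟨b * a * b⁻¹ * a⁻¹, Kl1_commutator_mem hϖ hl hr ha hb⟩ =
            tauTrace ϖ τ 1 (X * β - β * X) Y := fun b hb Y hY =>
      psiBeta_commutator hϖ hτ (d := l - 2) _ _ _ (by omega) (by omega) (by omega) β hX' hY _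
    constructor
    · intro h b hb
      obtain ⟨Y, hY⟩ := exists_coeff hϖ ⟨b, hb⟩
      exact (hval b hb Y hY).trans (h Y)
    · intro h Y
      obtain ⟨b, hb⟩ := exists_isCoeff hϖ r (i := l - 1) (by omega) Y
      have hb' : b ∈ Kl1 F n hl hr := hb.mem_K hϖ (by omega)
      exact (hval b hb' Y hb).symm.trans (h b hb')
  decomp ε hε h hh := by
    obtain ⟨X, hX⟩ := exists_coeff hϖ ⟨h, KBeta_le_Kl1 hϖ hl hr β hh⟩
    have hX' : IsCoeff ϖ (l - 1) h X := hX
    obtain ⟨f, hf⟩ := exists_aeval_bar_eq ((mem_KU_iff hϖ _ _ hX').1 hh)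
    obtain ⟨Z, hZ⟩ := (bar_eq_iff hϖ).1 hf
    -- Replacing the coefficient by a polynomial in `β` with the same reduction changes `h` only by
    -- an element of $K_l$, and the new element commutes with $\mathcal C$.
    obtain ⟨c, hc⟩ := exists_isCoeff hϖ r (i := l - 1) (by omega) (Polynomial.aeval β f)
    refine ⟨c, (mem_KU_iff hϖ _ _ hc).2 (hf ▸ (mem_KU_iff hϖ _ _ hX').1 hh), c⁻¹ * h, ?_,
      (mul_inv_cancel_left c h).symm, ?_⟩
    · change Matrix.GeneralLinearGroup.map (n := Fin n)
        (Ideal.Quotient.factorPow (IsLocalRing.maximalIdeal 𝒪[F]) _) (c⁻¹ * h) = 1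
      rw [map_mul, map_inv, inv_mul_eq_one]
      apply Units.ext
      rw [map_val_eq _ hc, map_val_eq _ hX', red_eq_iff hϖ]
      refine ⟨-Z, ?_⟩
      rw [hZ, smul_add, smul_smul, ← pow_succ, Nat.sub_add_cancel (by omega), smul_neg, add_assoc,
        add_assoc, add_neg_cancel, add_zero]
    · have h1 : Commute (red r β) c.val := by
        have h2 : Commute β (Polynomial.aeval β f) :=
          Algebra.commute_of_mem_adjoin_self (Polynomial.aeval_mem_adjoin_singleton _ β)
        have h3 : Commute β (1 + ϖ ^ (l - 1) • Polynomial.aeval β f) :=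
          (Commute.one_right β).add_right (h2.smul_right _)
        rw [hc, commute_iff_eq, ← red_mul, h3.eq, red_mul]
      exact Units.ext (Algebra.commute_of_mem_adjoin_singleton_of_commute hε.1 h1.symm).symm.eq

end LocalField

end RegChar

open RegChar in
theorem mainTheorem1 {F : Type u} [Field F] [ValuativeRel F] [TopologicalSpace F]
    [IsNonarchimedeanLocalField F]
    {ϖ : 𝒪[F]} (hϖ : Irreducible ϖ)
    {τ : AddChar F Circle} (hτc : Continuous τ)
    (hτ : ∀ x : F, (∀ y : 𝒪[F], τ (x * y) = 1) ↔ x ∈ 𝒪[F])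
    {n r l : ℕ} (hl : 2 ≤ l) (hr : r = 2 * l - 1)
    (β : Matrix (Fin n) (Fin n) 𝒪[F]) (hβ : IsRegularMat β)
    (hyp : SchurHypothesis hϖ hτ hl hr β) :
    -- `π_ψ` exists, is unique up to equivalence, and has an extension to `𝒞 K_{l-1}`
    (∀ ψ ∈ Y hϖ hτ hl hr β,
      (∃ A : Rep.{u} ℂ (Kl1 F n hl hr), IsPi hϖ hl hr β ψ A) ∧
      (∀ A A' : Rep.{u} ℂ (Kl1 F n hl hr),
        IsPi hϖ hl hr β ψ A → IsPi hϖ hl hr β ψ A' → Nonempty (A ≅ A')) ∧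
      (∀ A : Rep.{u} ℂ (Kl1 F n hl hr), IsPi hϖ hl hr β ψ A →
        ∃ B : Rep.{u} ℂ (CK hl hr β), IsExtension hl hr β A B)) ∧
    -- the bijection, for every choice of the `π_ψ` and of their extensions
    (∀ (π : Y hϖ hτ hl hr β → Rep.{u} ℂ (Kl1 F n hl hr))
       (πext : Y hϖ hτ hl hr β → Rep.{u} ℂ (CK hl hr β)),
      (∀ ψ, IsPi hϖ hl hr β ψ.1 (π ψ)) →
      (∀ ψ, IsExtension hl hr β (π ψ) (πext ψ)) →
      Set.BijOn
        (fun p : (C r β ⧸ (Kl1 F n hl hr).subgroupOf (C r β) →* ℂˣ) × Y hϖ hτ hl hr β =>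
          repClass (Rep.ind (CK hl hr β).subtype
            (charTensor (inflateChar (C r β) (Kl1 F n hl hr) p.1) (πext p.2))))
        Set.univ
        (IrrOver (Kl F n hl hr).subtype (psi hϖ hτ hl hr β))) := by
  have D := isHeisenbergDatum hϖ hτ hl hr hβ
  refine ⟨fun ψ hψ => ⟨?_, ?_, ?_⟩, fun π πext hπ hext => D.bijOn_ind rfl π πext hπ hext⟩
  · exact exists_irreducible_over (Subgroup.inclusion_injective _) (D.conj_mem hψ)
  · rintro A A' ⟨hA, hAψ⟩ ⟨hA', hAψ'⟩
    obtain ⟨v, hv, h⟩ := (liesOver_iff _ _ _).1 hAψ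
    obtain ⟨w, hw, h'⟩ := (liesOver_iff _ _ _).1 hAψ'
    obtain ⟨e⟩ := D.equiv_of_liesOver hψ hA hA' hv h hw h'
    exact ⟨Rep.mkIso e⟩
  · rintro A ⟨hA, hAψ⟩
    exact D.exists_extension hψ hA hAψ (hyp ψ hψ A ⟨hA, hAψ⟩)
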